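/- Let $\Sigma$ be a compact hyperbolic surface with geodesic boundary, and let $S(\Sigma)$ be its unit tangent bundle. A geodesic path is a unit speed geodesic $[a,b]\to\Sigma$. **Graph of a vector.** For $v\in S(\Sigma)$ let $g_v^+$ and $g_v^-$ be the unit speed geodesic rays in $\Sigma$ with initial velocities $v$ and $-v$. (If the base point of $v$ lies on $\partial\Sigma$ and $\pm v$ points out of $\Sigma$, then the ray $g_v^{\pm}$ consists of the time $0$ only.) Let both rays grow from time $0$ at unit speed. A ray is stopped at the first time at which it reaches $\partial\Sigma$ at a positive time, or cannot be continued in $\Sigma$, or reaches a point already drawn by itself or by the other ray; a stopped ray is kept as it is, and the other ray grows on until it is stopped too. If the two rays reach the same point at the same positive time, this stops $g_v^+$ but not $g_v^-$. Let $t_+,t_-\in[0,\infty]$ be the stopping times of $g_v^+$ and $g_v^-$ (with $\infty$ if a ray is never stopped). The graph of $v$ is $$G_\Sigma(v)=g_v^+([0,t_+])\cup g_v^-([0,t_-])\cup B,$$ where $[0,\infty]$ is read as $[0,\infty)$ and $B$ is the union of those components of $\partial\Sigma$ that contain an end point $g_v^+(t_+)$ or $g_v^-(t_-)$. **Lassos.**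 A positively oriented lasso is a geodesic path $\alpha:[T_1,T_2]\to\Sigma$ such that $\alpha(T_1)\in\partial\Sigma$, $\alpha$ is injective on $(T_1,T_2)$, and $\alpha(T_3)=\alpha(T_2)$ for some $T_1\le T_3<T_2$. The point $\alpha(T_3)=\alpha(T_2)$ is its knot. **Proposition.** Let $\alpha:[T_1,T_2]\to\Sigma$ be a positively oriented lasso with knot $\alpha(T_3)=\alpha(T_2)$, and suppose that $T_1<T_3$, i.e. that the knot is not the base point $\alpha(T_1)$. Then for every $t\in[T_1,T_2]$, $$G_\Sigma(\alpha'(t))\setminus\partial\Sigma=\alpha((T_1,T_2])\quad\Longleftrightarrow\quad T_1\le t\le\frac{T_2+T_3}{2}.$$ -/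

import Mathlib

open scoped Topology UpperHalfPlane

noncomputable section

namespace Hyp

/-- A closed half-plane of the hyperbolic plane: the part of the upper half-plane on one side
(boundary included) of the complete geodesic `re z = 0`. It is the local model of a hyperbolic
surface with geodesic boundary. -/
abbrev HalfPlane : Type := {z : ℍ // 0 ≤ z.re}

/-- A hyperbolic surface with geodesic boundary: a space with charts in `HalfPlane` whose
transition maps are locally restrictions of isometries of the hyperbolic plane. The isometry group
is `GL(2, ℝ)` modulo scalars, acting by Möbius maps (determinant positive) and by Möbius maps
composed with complex conjugation (determinant negative). -/
class HyperbolicSurface (S : Type*) [TopologicalSpace S] [ChartedSpace HalfPlane S] : Prop where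
  transition : ∀ e ∈ atlas HalfPlane S, ∀ e' ∈ atlas HalfPlane S, ∀ p ∈ e.source ∩ e'.source,
    ∃ g : GL (Fin 2) ℝ, ∀ᶠ q in 𝓝 p, (e' q : ℍ) = g • (e q : ℍ)

/-- The unit speed parametrization `s ↦ i * exp s` of the geodesic `re z = 0`. Every unit speed
geodesic of the hyperbolic plane is `s ↦ g • axis s` for an isometry `g`. -/
def axis (s : ℝ) : ℍ := ⟨(Real.exp s : ℂ) * Complex.I, by
  rw [Complex.im_ofReal_mul]; simpa using Real.exp_pos s⟩

section

variable {S : Type*} [TopologicalSpace S] [ChartedSpace HalfPlane S]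

/-- The coordinate, in the upper half-plane, of the point `q` in the preferred chart at `p`. -/
def coord (p q : S) : ℍ := (chartAt HalfPlane p q : ℍ)

variable (S) in
/-- The boundary of the surface: the points whose coordinate lies on the boundary geodesic of
`HalfPlane`. -/
def bdry : Set S := {p | (coord p p).re = 0}

/-- `γ` restricted to `I` is a unit speed geodesic path of the surface: in charts it is locally a
unit speed geodesic of the hyperbolic plane. The values of `γ` outside `I` play no role. -/
def IsGeodesicOn (γ : ℝ → S) (I : Set ℝ) : Prop :=
  ∀ t ∈ I, ∃ g : GL (Fin 2) ℝ, ∀ᶠ s in 𝓝[I] t,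
    γ s ∈ (chartAt HalfPlane (γ t)).source ∧ coord (γ t) (γ s) = g • axis s

variable (S) in
/-- Tangent vectors of the surface; the component `vec` is the expression of the vector in the
preferred chart at the base point. -/
@[ext]
structure TangentVec where
  base : S
  vec : ℂ

/-- The opposite tangent vector. -/
instance : Neg (TangentVec S) := ⟨fun v => ⟨v.base, -v.vec⟩⟩

variable (S) in
/-- The unit tangent bundle, for the hyperbolic metric `|dz| / im z`. -/
def unitTangentBundle : Set (TangentVec S) := {v | ‖v.vec‖ = (coord v.base v.base).im}

/-- The velocity vector at time `t` of a path `γ` with domain `I` (one-sided at an end of `I`). -/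
def velocity (γ : ℝ → S) (I : Set ℝ) (t : ℝ) : TangentVec S :=
  ⟨γ t, derivWithin (fun s => (coord (γ t) (γ s) : ℂ)) I t⟩

/-- `γ` restricted to `[0, T]` is the geodesic path in the surface with initial velocity `v`. For
`T = 0` this is the constant path at the base point of `v`. -/
def IsRay (v : TangentVec S) (γ : ℝ → S) (T : ℝ) : Prop :=
  γ 0 = v.base ∧ IsGeodesicOn γ (Set.Icc 0 T) ∧ (0 < T → velocity γ (Set.Icc 0 T) 0 = v)

/-- The times `t ≥ 0` up to which the geodesic ray with initial velocity `v` exists in the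
surface. For a vector at a boundary point that points out of the surface this is `{0}`. -/
def rayDomain (v : TangentVec S) : Set ℝ := {t | 0 ≤ t ∧ ∃ γ : ℝ → S, IsRay v γ t}

open Classical in
/-- The geodesic ray with initial velocity `v`, at a time `t` in `rayDomain v`. The two rays
determined by `v` are `ray v` (forward) and `ray (-v)` (backward). -/
def ray (v : TangentVec S) (t : ℝ) : S :=
  if h : ∃ γ : ℝ → S, IsRay v γ t then h.choose t else v.base

/-- At time `t` the ray with initial velocity `v` is stopped by the boundary: it runs into the
boundary at a positive time, or it cannot be continued inside the surface. -/
def HitsBdry (v : TangentVec S) (t : ℝ) : Prop :=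
  (0 < t ∧ ray v t ∈ bdry S) ∨ ∀ s ∈ rayDomain v, s ≤ t

/-- At time `t` the ray with initial velocity `v` runs into its own past. -/
def HitsSelf (v : TangentVec S) (t : ℝ) : Prop := ∃ s ∈ Set.Ico 0 t, ray v s = ray v t

/-- The first time at which the forward ray of `v` hits the boundary, itself, or the part of the
backward ray that is already drawn, where the backward ray grows at the same speed and is frozen
at time `τ`. It is `⊤` if this never happens. -/
def stopForward (v : TangentVec S) (τ : EReal) : EReal :=
  sInf ((fun t : ℝ => (t : EReal)) '' {t | t ∈ rayDomain v ∧
    (HitsBdry v t ∨ HitsSelf v t ∨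
      (0 < t ∧ ∃ s ∈ Set.Icc 0 t ∩ rayDomain (-v), (s : EReal) ≤ τ ∧ ray (-v) s = ray v t))})

/-- The first time at which the backward ray of `v` hits the boundary, itself, or the part of the
forward ray that is already drawn, where the forward ray grows at the same speed and is frozen
at time `τ`. When the two rays meet head-on (same point, same time), the forward ray is the one
that is stopped; hence only the points drawn strictly before time `t` are obstacles here. -/
def stopBackward (v : TangentVec S) (τ : EReal) : EReal :=
  sInf ((fun t : ℝ => (t : EReal)) '' {t | t ∈ rayDomain (-v) ∧
    (HitsBdry (-v) t ∨ HitsSelf (-v) t ∨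
      ∃ s ∈ Set.Ico 0 t ∩ rayDomain v, (s : EReal) ≤ τ ∧ ray v s = ray (-v) t)})

open Classical in
/-- The pair of lengths of the forward and of the backward ray in the graph of `v`. Both rays grow
at unit speed; the ray that is stopped first is frozen, and the other one grows on until it is
stopped too. -/
def stopTimes (v : TangentVec S) : EReal × EReal :=
  if stopForward v ⊤ ≤ stopBackward v ⊤ then
    (stopForward v ⊤, stopBackward v (stopForward v ⊤))
  else
    (stopForward v (stopBackward v ⊤), stopBackward v ⊤)

/-- The arc drawn by the ray with initial velocity `v` up to time `τ`. -/
def arc (v : TangentVec S) (τ : EReal) : Set S :=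
  ray v '' {t | t ∈ rayDomain v ∧ (t : EReal) ≤ τ}

/-- The boundary component at which the ray with initial velocity `v` ends at time `τ`; it is empty
if the end point is not in the boundary. -/
def endComponent (v : TangentVec S) (τ : EReal) : Set S :=
  {q | ∃ t ∈ rayDomain v, (t : EReal) = τ ∧ q ∈ connectedComponentIn (bdry S) (ray v t)}

/-- The graph of a unit tangent vector `v` in the surface: the two geodesic arcs grown from `v`
together with the boundary components at which they end. -/
def graph (v : TangentVec S) : Set S :=
  arc v (stopTimes v).1 ∪ arc (-v) (stopTimes v).2 ∪
    (endComponent v (stopTimes v).1 ∪ endComponent (-v) (stopTimes v).2)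

/-- `α : [T₁, T₂] → S` is a positively oriented lasso with base point `α T₁` and with knot
`α T₃ = α T₂`. -/
structure IsPositiveLasso (α : ℝ → S) (T₁ T₂ T₃ : ℝ) : Prop where
  geodesic : IsGeodesicOn α (Set.Icc T₁ T₂)
  base_mem : α T₁ ∈ bdry S
  injOn : Set.InjOn α (Set.Ioo T₁ T₂)
  le : T₁ ≤ T₃
  lt : T₃ < T₂
  knot : α T₃ = α T₂

/-- Geodesic paths have unit speed. -/
theorem velocity_mem_unitTangentBundle {γ : ℝ → S} {a b t : ℝ} (hab : a < b)
    (ht : t ∈ Set.Icc a b) (hγ : IsGeodesicOn γ (Set.Icc a b)) :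
    velocity γ (Set.Icc a b) t ∈ unitTangentBundle S := by
  obtain ⟨g, hg⟩ := hγ t ht
  have ht0 : coord (γ t) (γ t) = g • axis t := (hg.self_of_nhdsWithin ht).2
  have hd : UpperHalfPlane.denom g (axis t) ≠ 0 := UpperHalfPlane.denom_ne_zero g (axis t)
  have hax : HasDerivAt (fun s : ℝ => (axis s : ℂ)) ((Real.exp t : ℂ) * Complex.I) t := by
    simpa [axis] using ((Real.hasDerivAt_exp t).ofReal_comp).mul_const Complex.I
  have hn : HasDerivAt (fun s : ℝ => UpperHalfPlane.num g (axis s))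
      ((g 0 0 : ℂ) * ((Real.exp t : ℂ) * Complex.I)) t := by
    simpa [UpperHalfPlane.num] using (hax.const_mul (g 0 0 : ℂ)).add_const (g 0 1 : ℂ)
  have hde : HasDerivAt (fun s : ℝ => UpperHalfPlane.denom g (axis s))
      ((g 1 0 : ℂ) * ((Real.exp t : ℂ) * Complex.I)) t := by
    simpa [UpperHalfPlane.denom] using (hax.const_mul (g 1 0 : ℂ)).add_const (g 1 1 : ℂ)
  have hq := hn.div hde hd
  have hσ := ((UpperHalfPlane.σ g).toContinuousLinearEquiv.toContinuousLinearMap.hasFDerivAt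
    (x := UpperHalfPlane.num g (axis t) / UpperHalfPlane.denom g (axis t))).comp_hasDerivAt t hq
  have hw : HasDerivWithinAt (fun s => (coord (γ t) (γ s) : ℂ)) _ (Set.Icc a b) t :=
    hσ.hasDerivWithinAt.congr_of_eventuallyEq
      (hg.mono fun s hs => by simp only [hs.2]; rfl) (by simp only [ht0]; rfl)
  have hv := hw.derivWithin (uniqueDiffOn_Icc hab t ht)
  change ‖derivWithin (fun s => (coord (γ t) (γ s) : ℂ)) (Set.Icc a b) t‖ = (coord (γ t) (γ t)).im
  rw [hv, ht0, UpperHalfPlane.im_smul_eq_div_normSq]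
  have hdet : (g.det.val : ℂ) = g 0 0 * g 1 1 - g 0 1 * g 1 0 := by
    simp [Matrix.det_fin_two]
  have hnum : (g 0 0 : ℂ) * ((Real.exp t : ℂ) * Complex.I) * UpperHalfPlane.denom g (axis t) -
      UpperHalfPlane.num g (axis t) * ((g 1 0 : ℂ) * ((Real.exp t : ℂ) * Complex.I)) =
      (g.det.val : ℂ) * ((Real.exp t : ℂ) * Complex.I) := by
    rw [hdet, UpperHalfPlane.num, UpperHalfPlane.denom]; ring
  change ‖UpperHalfPlane.σ g _‖ = _
  rw [UpperHalfPlane.norm_σ, hnum, Complex.normSq_eq_norm_sq]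
  have him : (axis t).im = Real.exp t := by
    change ((Real.exp t : ℂ) * Complex.I).im = _
    rw [Complex.im_ofReal_mul]; simp
  have he : ‖(Real.exp t : ℂ)‖ = Real.exp t := by
    rw [Complex.norm_real, Real.norm_of_nonneg (Real.exp_pos t).le]
  rw [him, norm_div, norm_mul, norm_mul, he, norm_pow, Complex.norm_real, Real.norm_eq_abs,
    Complex.norm_I, mul_one]

end

end Hyp

end

/-!
Since `T₁ < T₃`, the knot is not on the boundary: a geodesic that touches the boundary at an
interior time lies in it, and then both strands of the lasso at the knot would lie in the boundary
geodesic and overlap. Hence the lasso can be prolonged beyond `T₂` to a geodesic `β : [T₁, T] → S`.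
Two geodesics of the hyperbolic plane with two common points, or with a common velocity, coincide,
so the two strands at the knot meet there only, and for `T` close to `T₂` the knot is the only
double point of `β`. Both rays of `α'(t)` therefore run along `β`: the backward one ends at the base
point, and the forward one is at the knot `β T₂` at time `T₂ - t`. If `t ≤ T₃`, it has itself been
there before; otherwise the backward ray is there at time `t - T₃`, which is no later than `T₂ - t`
exactly when `t ≤ (T₂ + T₃) / 2`. If so, the forward ray stops at the knot. If not, it runs on to
`β T`, which is not on the lasso.
-/

namespace Hyp

/-! ### Geodesics of the hyperbolic plane -/

theorem axis_re (s : ℝ) : (axis s).re = 0 := by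
  change ((Real.exp s : ℂ) * Complex.I).re = 0
  simp

theorem axis_im (s : ℝ) : (axis s).im = Real.exp s := by
  change ((Real.exp s : ℂ) * Complex.I).im = Real.exp s
  simp only [Complex.im_ofReal_mul, Complex.I_im, mul_one]

theorem dist_axis (s t : ℝ) : dist (axis s) (axis t) = |s - t| := by
  rw [UpperHalfPlane.dist_of_re_eq (by rw [axis_re, axis_re]), axis_im, axis_im, Real.log_exp,
    Real.log_exp, Real.dist_eq]

theorem eq_axis_of_re_eq_zero {z : ℍ} (hz : z.re = 0) : z = axis (Real.log z.im) :=
  UpperHalfPlane.ext_re_im (hz.trans (axis_re _).symm) (by rw [axis_im, Real.exp_log z.im_pos])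

theorem dist_smul_smul (g : GL (Fin 2) ℝ) (z w : ℍ) : dist (g • z) (g • w) = dist z w := by
  have hz := UpperHalfPlane.denom_ne_zero g z
  have hw := UpperHalfPlane.denom_ne_zero g w
  have hsub : UpperHalfPlane.num g z / UpperHalfPlane.denom g z -
      UpperHalfPlane.num g w / UpperHalfPlane.denom g w =
      g.det.val * ((z : ℂ) - w) / (UpperHalfPlane.denom g z * UpperHalfPlane.denom g w) := by
    rw [div_sub_div _ _ hz hw, Matrix.GeneralLinearGroup.val_det_apply, Matrix.det_fin_two]
    simp only [UpperHalfPlane.num, UpperHalfPlane.denom]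
    push_cast
    ring
  refine Real.cosh_strictMonoOn.injOn dist_nonneg dist_nonneg ?_
  rw [UpperHalfPlane.cosh_dist, UpperHalfPlane.cosh_dist, UpperHalfPlane.im_smul_eq_div_normSq,
    UpperHalfPlane.im_smul_eq_div_normSq, UpperHalfPlane.coe_smul, UpperHalfPlane.coe_smul,
    dist_eq_norm, dist_eq_norm, ← map_sub, UpperHalfPlane.norm_σ, hsub, norm_div, norm_mul,
    norm_mul, Complex.norm_real, Real.norm_eq_abs, Complex.normSq_eq_norm_sq,
    Complex.normSq_eq_norm_sq]
  have := norm_ne_zero_iff.2 hz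
  have := norm_ne_zero_iff.2 hw
  have := abs_ne_zero.2 g.det.ne_zero
  have := z.im_ne_zero
  have := w.im_ne_zero
  field_simp

theorem dist_smul_axis (g : GL (Fin 2) ℝ) (s t : ℝ) :
    dist (g • axis s) (g • axis t) = |s - t| := by
  rw [dist_smul_smul, dist_axis]

theorem smul_axis_injective (g : GL (Fin 2) ℝ) : Function.Injective fun s => g • axis s :=
  fun s t h => by
    have h0 := dist_eq_zero.2 h
    rwa [dist_smul_axis, abs_eq_zero, sub_eq_zero] at h0

theorem exists_cosh_dist_smul_axis (g : GL (Fin 2) ℝ) (w : ℍ) : ∃ A B : ℝ, ∀ s,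
    Real.cosh (dist (g • axis s) w) = A * Real.exp s + B * Real.exp (-s) := by
  set z := g⁻¹ • w
  refine ⟨1 / (2 * z.im), (z.re ^ 2 + z.im ^ 2) / (2 * z.im), fun s => ?_⟩
  have hz : z.im ≠ 0 := z.im_ne_zero
  have hs : Real.exp s ≠ 0 := (Real.exp_pos s).ne'
  rw [← dist_smul_smul g⁻¹, inv_smul_smul, UpperHalfPlane.cosh_dist', axis_re, axis_im,
    Real.exp_neg]
  field_simp
  ring

theorem smul_axis_eq_of_forall_cosh_dist {g h : GL (Fin 2) ℝ} {u : ℝ}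
    (H : ∀ w, Real.cosh (dist (g • axis u) w) = Real.cosh (dist (h • axis u) w)) :
    g • axis u = h • axis u := by
  have hd := Real.cosh_strictMonoOn.injOn dist_nonneg dist_nonneg (H (h • axis u))
  rwa [dist_self, dist_eq_zero] at hd

theorem smul_axis_eq_of_eq_of_eq {g h : GL (Fin 2) ℝ} {s t : ℝ} (hst : s ≠ t)
    (hs : g • axis s = h • axis s) (ht : g • axis t = h • axis t) (u : ℝ) :
    g • axis u = h • axis u := by
  refine smul_axis_eq_of_forall_cosh_dist fun w => ?_
  obtain ⟨A, B, hg⟩ := exists_cosh_dist_smul_axis g w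
  obtain ⟨A', B', hh⟩ := exists_cosh_dist_smul_axis h w
  have hne : Real.exp s ^ 2 - Real.exp t ^ 2 ≠ 0 := by
    rw [sub_ne_zero, Ne, pow_left_inj₀ (Real.exp_pos s).le (Real.exp_pos t).le two_ne_zero]
    exact Real.exp_injective.ne hst
  have key : ∀ r, g • axis r = h • axis r → (A - A') * Real.exp r ^ 2 + (B - B') = 0 := by
    intro r hr
    have hr' := hg r
    have := (Real.exp_pos r).ne'
    rw [hr, hh, Real.exp_neg] at hr'
    field_simp at hr'
    linarith
  have hA : A - A' = 0 :=
    (mul_eq_zero.1 (by linear_combination key s hs - key t ht)).resolve_right hne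
  have hB : B - B' = 0 := by simpa only [hA, zero_mul, zero_add] using key s hs
  rw [hg, hh, sub_eq_zero.1 hA, sub_eq_zero.1 hB]

theorem exists_smul_axis_eq_add_mul (g : GL (Fin 2) ℝ) (c : ℝ) {ε : ℝ} (hε : |ε| = 1) :
    ∃ h : GL (Fin 2) ℝ, ∀ s, h • axis s = g • axis (c + ε * s) := by
  suffices H : ∃ k : GL (Fin 2) ℝ, ∀ s, k • axis s = axis (c + ε * s) by
    obtain ⟨k, hk⟩ := H
    exact ⟨g * k, fun s => by rw [mul_smul, hk]⟩
  rcases eq_or_eq_neg_of_abs_eq hε with rfl | rfl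
  · refine ⟨.mkOfDetNeZero !![Real.exp c, 0; 0, 1] (by simp), fun s => UpperHalfPlane.ext ?_⟩
    rw [UpperHalfPlane.coe_smul_of_det_pos
      (by simp [Matrix.GeneralLinearGroup.mkOfDetNeZero, Real.exp_pos])]
    simp [UpperHalfPlane.num, UpperHalfPlane.denom, Matrix.GeneralLinearGroup.mkOfDetNeZero, axis,
      Complex.exp_add, mul_assoc]
  · refine ⟨.mkOfDetNeZero !![0, -Real.exp c; 1, 0] (by simp), fun s => UpperHalfPlane.ext ?_⟩
    rw [UpperHalfPlane.coe_smul_of_det_pos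
      (by simp [Matrix.GeneralLinearGroup.mkOfDetNeZero, Real.exp_pos])]
    simp [UpperHalfPlane.num, UpperHalfPlane.denom, Matrix.GeneralLinearGroup.mkOfDetNeZero, axis,
      Complex.exp_add, Complex.exp_neg, div_eq_mul_inv, mul_comm, mul_left_comm]

theorem exists_smul_axis_eq_add_mul_sub {g h : GL (Fin 2) ℝ} {s t s' t' : ℝ} (hst : s ≠ t)
    (hs : g • axis s = h • axis s') (ht : g • axis t = h • axis t') :
    ∃ ε : ℝ, |ε| = 1 ∧ ∀ u, g • axis u = h • axis (s' + ε * (u - s)) := by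
  have hts : t - s ≠ 0 := sub_ne_zero.2 hst.symm
  have hd : |t' - s'| = |t - s| := by
    rw [← dist_smul_axis h, ← dist_smul_axis g, hs, ht]
  have hε : |(t' - s') / (t - s)| = 1 := by
    rw [abs_div, hd, div_self (abs_ne_zero.2 hts)]
  obtain ⟨k, hk⟩ := exists_smul_axis_eq_add_mul h (s' - (t' - s') / (t - s) * s) hε
  have hk' : ∀ u, k • axis u = h • axis (s' + (t' - s') / (t - s) * (u - s)) := fun u => by
    rw [hk]; ring_nf
  refine ⟨_, hε, fun u => ?_⟩
  rw [← hk']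
  refine smul_axis_eq_of_eq_of_eq hst ?_ ?_ u
  · rw [hs, hk', sub_self, mul_zero, add_zero]
  · rw [ht, hk', div_mul_cancel₀ _ hts, add_sub_cancel]

/-- The velocity at time `t` of the geodesic `s ↦ g • axis s`. -/
noncomputable def axisVelocity (g : GL (Fin 2) ℝ) (t : ℝ) : ℂ :=
  deriv (fun s => ((g • axis s : ℍ) : ℂ)) t

theorem hasDerivAt_smul_axis (g : GL (Fin 2) ℝ) (t : ℝ) :
    HasDerivAt (fun s => ((g • axis s : ℍ) : ℂ)) (axisVelocity g t) t := by
  refine DifferentiableAt.hasDerivAt ?_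
  have hax : DifferentiableAt ℝ (fun s => (axis s : ℂ)) t := by
    change DifferentiableAt ℝ (fun s : ℝ => (Real.exp s : ℂ) * Complex.I) t
    fun_prop
  have hnum : DifferentiableAt ℝ (fun s => UpperHalfPlane.num g (axis s)) t :=
    (hax.const_mul _).add_const _
  have hdenom : DifferentiableAt ℝ (fun s => UpperHalfPlane.denom g (axis s)) t :=
    (hax.const_mul _).add_const _
  simp_rw [UpperHalfPlane.coe_smul, div_eq_mul_inv]
  exact ((UpperHalfPlane.σ g).toContinuousLinearEquiv.differentiableAt).comp t
    (hnum.mul (hdenom.inv (UpperHalfPlane.denom_ne_zero g _)))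

theorem continuous_smul_axis (g : GL (Fin 2) ℝ) : Continuous fun s => g • axis s :=
  UpperHalfPlane.isEmbedding_coe.continuous_iff.2 <|
    continuous_iff_continuousAt.2 fun t => (hasDerivAt_smul_axis g t).continuousAt

theorem axisVelocity_eq_mul {g h : GL (Fin 2) ℝ} {c ε : ℝ}
    (hh : ∀ s, h • axis s = g • axis (c + ε * s)) (t : ℝ) :
    axisVelocity h t = ε * axisVelocity g (c + ε * t) := by
  have hd := (hasDerivAt_smul_axis g (c + ε * t)).scomp t
    (((hasDerivAt_id t).const_mul ε).const_add c)
  rw [mul_one, Complex.real_smul] at hd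
  refine HasDerivAt.deriv (f := fun s => ((h • axis s : ℍ) : ℂ)) ?_
  simp_rw [hh]
  exact hd

theorem deriv_cosh_dist_smul_axis_congr {g h : GL (Fin 2) ℝ} {t : ℝ}
    (hp : g • axis t = h • axis t) (hv : axisVelocity g t = axisVelocity h t) (w : ℍ) :
    deriv (fun s => Real.cosh (dist (g • axis s) w)) t =
      deriv (fun s => Real.cosh (dist (h • axis s) w)) t := by
  let F : ℂ → ℝ := fun z => ((z.re - w.re) ^ 2 + z.im ^ 2 + w.im ^ 2) / (2 * z.im * w.im)
  have hF : ∀ z : ℍ, DifferentiableAt ℝ F z := fun z => by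
    have hre : DifferentiableAt ℝ Complex.re (z : ℂ) := Complex.reCLM.differentiableAt
    have him : DifferentiableAt ℝ Complex.im (z : ℂ) := Complex.imCLM.differentiableAt
    have h0 : 2 * (z : ℂ).im * w.im ≠ 0 :=
      mul_ne_zero (mul_ne_zero two_ne_zero z.im_ne_zero) w.im_ne_zero
    simp only [F, div_eq_mul_inv]
    exact ((((hre.sub_const _).pow 2).add (him.pow 2)).add_const _).mul
      (((him.const_mul 2).mul_const _).inv h0)
  have hderiv : ∀ k : GL (Fin 2) ℝ, deriv (fun s => Real.cosh (dist (k • axis s) w)) t =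
      fderiv ℝ F (k • axis t : ℍ) (axisVelocity k t) := fun k => by
    simp_rw [UpperHalfPlane.cosh_dist']
    exact ((hF _).hasFDerivAt.comp_hasDerivAt t (hasDerivAt_smul_axis k t)).deriv
  rw [hderiv, hderiv, hp, hv]

theorem smul_axis_eq_of_velocity_eq {g h : GL (Fin 2) ℝ} {t : ℝ}
    (hp : g • axis t = h • axis t) (hv : axisVelocity g t = axisVelocity h t) (u : ℝ) :
    g • axis u = h • axis u := by
  refine smul_axis_eq_of_forall_cosh_dist fun w => ?_
  obtain ⟨A, B, hg⟩ := exists_cosh_dist_smul_axis g w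
  obtain ⟨A', B', hh⟩ := exists_cosh_dist_smul_axis h w
  have hderiv : ∀ C D : ℝ, deriv (fun s => C * Real.exp s + D * Real.exp (-s)) t =
      C * Real.exp t - D * Real.exp (-t) := fun C D => by
    have hd := ((Real.hasDerivAt_exp t).const_mul C).add
      (((hasDerivAt_neg t).exp).const_mul D)
    refine hd.deriv.trans ?_
    ring
  have h0 := hg t
  have h1 := deriv_cosh_dist_smul_axis_congr hp hv w
  rw [hp, hh] at h0
  simp_rw [hg, hh, hderiv] at h1
  have hA : A = A' := mul_right_cancel₀ (Real.exp_pos t).ne' (by linarith)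
  have hB : B = B' := mul_right_cancel₀ (Real.exp_pos (-t)).ne' (by linarith)
  rw [hg, hh, hA, hB]

theorem re_J_smul (z : ℍ) : (UpperHalfPlane.J • z).re = -z.re := by
  have := congrArg Complex.re (UpperHalfPlane.coe_J_smul z)
  simpa using this

theorem J_smul_eq_self_of_re_eq_zero {z : ℍ} (hz : z.re = 0) : UpperHalfPlane.J • z = z := by
  refine UpperHalfPlane.ext_re_im (by rw [re_J_smul, hz, neg_zero]) ?_
  simpa using congrArg Complex.im (UpperHalfPlane.coe_J_smul z)

theorem axisVelocity_J_mul (g : GL (Fin 2) ℝ) (t : ℝ) :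
    axisVelocity (UpperHalfPlane.J * g) t = -(starRingEnd ℂ) (axisVelocity g t) := by
  have hd := (Complex.conjCLE.hasFDerivAt.comp_hasDerivAt t (hasDerivAt_smul_axis g t)).neg
  simp_rw [axisVelocity, mul_smul, UpperHalfPlane.coe_J_smul]
  exact hd.deriv

theorem re_smul_axis_eq_zero_of_J_mul {g : GL (Fin 2) ℝ} {u : ℝ}
    (h : (UpperHalfPlane.J * g) • axis u = g • axis u) : (g • axis u).re = 0 := by
  have hre := congrArg UpperHalfPlane.re h
  rw [mul_smul, re_J_smul] at hre
  linarith

theorem re_smul_axis_eq_zero_of_velocity {g : GL (Fin 2) ℝ} {t : ℝ} (ht : (g • axis t).re = 0)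
    (hv : (axisVelocity g t).re = 0) (u : ℝ) : (g • axis u).re = 0 := by
  refine re_smul_axis_eq_zero_of_J_mul (smul_axis_eq_of_velocity_eq (t := t) ?_ ?_ u)
  · rw [mul_smul, J_smul_eq_self_of_re_eq_zero ht]
  · rw [axisVelocity_J_mul]
    exact Complex.ext (by simp [hv]) (by simp)

theorem re_smul_axis_eq_zero_of_ne {g : GL (Fin 2) ℝ} {s t : ℝ} (hst : s ≠ t)
    (hs : (g • axis s).re = 0) (ht : (g • axis t).re = 0) (u : ℝ) : (g • axis u).re = 0 := by
  refine re_smul_axis_eq_zero_of_J_mul (smul_axis_eq_of_eq_of_eq hst ?_ ?_ u) <;>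
    rw [mul_smul, J_smul_eq_self_of_re_eq_zero ‹_›]

theorem hasDerivAt_re_smul_axis (g : GL (Fin 2) ℝ) (t : ℝ) :
    HasDerivAt (fun s => (g • axis s).re) (axisVelocity g t).re t :=
  Complex.reCLM.hasFDerivAt.comp_hasDerivAt t (hasDerivAt_smul_axis g t)

theorem re_smul_axis_eq_zero_of_eventually_nonneg {g : GL (Fin 2) ℝ} {t : ℝ}
    (ht : (g • axis t).re = 0) (h : ∀ᶠ s in 𝓝 t, 0 ≤ (g • axis s).re) (u : ℝ) :
    (g • axis u).re = 0 := by
  have hmin : IsLocalMin (fun s => (g • axis s).re) t := by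
    filter_upwards [h] with s hs
    rwa [ht]
  exact re_smul_axis_eq_zero_of_velocity ht
    (hmin.hasDerivAt_eq_zero (hasDerivAt_re_smul_axis g t)) u

/-! ### Geodesics in charts -/

theorem re_pos_of_eventually_nonneg {z : ℍ} (h : ∀ᶠ w in 𝓝 z, 0 ≤ w.re) : 0 < z.re := by
  have hc : Continuous fun r : ℝ => r +ᵥ z := by
    rw [UpperHalfPlane.isEmbedding_coe.continuous_iff]
    change Continuous fun r : ℝ => (r : ℂ) + (z : ℂ)
    fun_prop
  have hz : Filter.Tendsto (fun r : ℝ => r +ᵥ z) (𝓝[<] 0) (𝓝 z) := by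
    simpa only [zero_vadd] using (hc.tendsto 0).mono_left nhdsWithin_le_nhds
  obtain ⟨r, hr, hr0 : r < 0⟩ := ((hz.eventually h).and self_mem_nhdsWithin).exists
  rw [UpperHalfPlane.vadd_re] at hr
  linarith

section

variable {S : Type*} [TopologicalSpace S]

theorem map_coe_chart_nhds {e : OpenPartialHomeomorph S HalfPlane} {p : S} (hp : p ∈ e.source)
    (h : 0 < (e p : ℍ).re) : Filter.map (fun q => (e q : ℍ)) (𝓝 p) = 𝓝 (e p : ℍ) := by
  have hint : ∀ᶠ z : ℍ in 𝓝 (e p : ℍ), 0 ≤ z.re :=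
    (UpperHalfPlane.continuous_re.continuousAt.eventually (lt_mem_nhds h)).mono fun _ => le_of_lt
  rw [← map_nhds_subtype_coe_eq_nhds (p := fun z : ℍ => 0 ≤ z.re) (e p).2 hint, Subtype.coe_eta,
    ← e.map_nhds_eq hp, Filter.map_map]
  rfl

variable [ChartedSpace HalfPlane S]

theorem coord_re_nonneg (p q : S) : 0 ≤ (coord p q).re := (chartAt HalfPlane p q).2

theorem eq_of_coord_eq {p q q' : S} (hq : q ∈ (chartAt HalfPlane p).source)
    (hq' : q' ∈ (chartAt HalfPlane p).source) (h : coord p q = coord p q') : q = q' :=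
  (chartAt HalfPlane p).injOn hq hq' (Subtype.ext h)

theorem chart_re_eq_zero_of_re_eq_zero [HyperbolicSurface S]
    {e e' : OpenPartialHomeomorph S HalfPlane} (he : e ∈ atlas HalfPlane S)
    (he' : e' ∈ atlas HalfPlane S) {p : S} (hp : p ∈ e.source) (hp' : p ∈ e'.source)
    (h : (e p : ℍ).re = 0) : (e' p : ℍ).re = 0 := by
  by_contra hne
  obtain ⟨g, hg⟩ := HyperbolicSurface.transition e he e' he' p ⟨hp, hp'⟩
  have hinv : ∀ᶠ w in 𝓝 (e' p : ℍ), 0 ≤ (g⁻¹ • w : ℍ).re := by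
    rw [← map_coe_chart_nhds hp' (lt_of_le_of_ne (e' p).2 (Ne.symm hne)), Filter.eventually_map]
    filter_upwards [hg] with q hq
    rw [hq, inv_smul_smul]
    exact (e q).2
  have hnonneg : ∀ᶠ z in 𝓝 (e p : ℍ), 0 ≤ z.re := by
    have hc := (continuous_const_smul g).tendsto (e p : ℍ)
    rw [← hg.self_of_nhds] at hc
    filter_upwards [hc.eventually hinv] with z hz
    rwa [inv_smul_smul] at hz
  exact (re_pos_of_eventually_nonneg hnonneg).ne' h

theorem mem_bdry_iff_coord [HyperbolicSurface S] {p q : S}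
    (hq : q ∈ (chartAt HalfPlane p).source) : q ∈ bdry S ↔ (coord p q).re = 0 :=
  ⟨chart_re_eq_zero_of_re_eq_zero (chart_mem_atlas _ q) (chart_mem_atlas _ p)
    (mem_chart_source _ q) hq,
    chart_re_eq_zero_of_re_eq_zero (chart_mem_atlas _ p) (chart_mem_atlas _ q) hq
    (mem_chart_source _ q)⟩

/-- In the preferred chart at `p`, the path `γ` with domain `I` is given near the time `t` by the
geodesic `s ↦ g • axis s`. -/
def HasGerm (γ : ℝ → S) (I : Set ℝ) (t : ℝ) (p : S) (g : GL (Fin 2) ℝ) : Prop :=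
  ∀ᶠ s in 𝓝[I] t, γ s ∈ (chartAt HalfPlane p).source ∧ coord p (γ s) = g • axis s

variable {γ β : ℝ → S} {I J : Set ℝ} {t : ℝ} {p : S} {g k : GL (Fin 2) ℝ}

theorem IsGeodesicOn.exists_hasGerm (hγ : IsGeodesicOn γ I) (ht : t ∈ I) :
    ∃ g, HasGerm γ I t (γ t) g := hγ t ht

namespace HasGerm

theorem mem_source (h : HasGerm γ I t p g) (ht : t ∈ I) : γ t ∈ (chartAt HalfPlane p).source :=
  (h.self_of_nhdsWithin ht).1

theorem coord_eq (h : HasGerm γ I t p g) (ht : t ∈ I) : coord p (γ t) = g • axis t :=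
  (h.self_of_nhdsWithin ht).2

theorem eventually_nhds (h : HasGerm γ I t p g) (hI : I ∈ 𝓝 t) :
    ∀ᶠ s in 𝓝 t, γ s ∈ (chartAt HalfPlane p).source ∧ coord p (γ s) = g • axis s :=
  (nhdsWithin_eq_nhds.2 hI).ge h

theorem mono (h : HasGerm γ I t p g) (hJ : J ⊆ I) : HasGerm γ J t p g :=
  Filter.Eventually.filter_mono (nhdsWithin_mono t hJ) h

theorem congr (h : HasGerm γ I t p g) (hβ : Set.EqOn β γ I) : HasGerm β I t p g := by
  filter_upwards [h, self_mem_nhdsWithin] with s hs hsI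
  rwa [hβ hsI]

theorem union (h : HasGerm γ I t p g) (h' : HasGerm γ J t p g) : HasGerm γ (I ∪ J) t p g := by
  rw [HasGerm, nhdsWithin_union]
  exact Filter.eventually_sup.2 ⟨h, h'⟩

theorem continuousWithinAt (h : HasGerm γ I t p g) (ht : t ∈ I) : ContinuousWithinAt γ I t := by
  rw [(chartAt HalfPlane p).continuousWithinAt_iff_continuousWithinAt_comp_left (h.mem_source ht)
    (Filter.Eventually.mono h fun _ hs => hs.1)]
  refine (⟨rfl⟩ : Topology.IsInducing ((↑) : HalfPlane → ℍ)).continuousWithinAt_iff.2 ?_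
  exact (continuous_smul_axis g).continuousWithinAt.congr_of_eventuallyEq
    (Filter.Eventually.mono h fun _ hs => hs.2) (h.coord_eq ht)

theorem exists_hasGerm_self [HyperbolicSurface S] (h : HasGerm γ I t p g) (ht : t ∈ I) :
    ∃ k, HasGerm γ I t (γ t) k := by
  have hc := h.continuousWithinAt ht
  obtain ⟨k, hk⟩ := HyperbolicSurface.transition _ (chart_mem_atlas HalfPlane p) _
    (chart_mem_atlas HalfPlane (γ t)) (γ t) ⟨h.mem_source ht, mem_chart_source _ _⟩
  refine ⟨k * g, ?_⟩
  filter_upwards [h, hc.eventually hk,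
    hc.eventually (chart_source_mem_nhds HalfPlane (γ t))] with s hs hs' hsource
  refine ⟨hsource, ?_⟩
  rw [mul_smul, ← hs.2]
  exact hs'

theorem mem_bdry_iff [HyperbolicSurface S] (h : HasGerm γ I t p g) :
    ∀ᶠ s in 𝓝[I] t, (γ s ∈ bdry S ↔ (g • axis s).re = 0) := by
  filter_upwards [h] with s hs
  rw [mem_bdry_iff_coord hs.1, hs.2]

theorem re_nonneg (h : HasGerm γ I t p g) : ∀ᶠ s in 𝓝[I] t, 0 ≤ (g • axis s).re := by
  filter_upwards [h] with s hs
  rw [← hs.2]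
  exact coord_re_nonneg _ _

theorem velocity_eq (h : HasGerm γ I t (γ t) g) (ht : t ∈ I) (hI : UniqueDiffWithinAt ℝ I t) :
    velocity γ I t = ⟨γ t, axisVelocity g t⟩ := by
  have hd : HasDerivWithinAt (fun s => (coord (γ t) (γ s) : ℂ)) (axisVelocity g t) I t :=
    (hasDerivAt_smul_axis g t).hasDerivWithinAt.congr_of_eventuallyEq
      (Filter.Eventually.mono h fun _ hs => congrArg _ hs.2) (congrArg _ (h.coord_eq ht))
  rw [velocity, hd.derivWithin hI]

theorem comp_add_mul {c ε : ℝ} (h : HasGerm γ I (c + ε * t) p g)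
    (hJ : Set.MapsTo (fun s => c + ε * s) J I)
    (hk : ∀ s, k • axis s = g • axis (c + ε * s)) :
    HasGerm (fun s => γ (c + ε * s)) J t p k := by
  have hc : Continuous fun s => c + ε * s := by fun_prop
  filter_upwards [(hc.continuousWithinAt.tendsto_nhdsWithin hJ).eventually h] with s hs
  rwa [hk]

theorem eventuallyEq (hγ : HasGerm γ I t p g) (hβ : HasGerm β I t p k)
    (h : ∀ u, g • axis u = k • axis u) : γ =ᶠ[𝓝[I] t] β := by
  filter_upwards [hγ, hβ] with s hs hs'
  exact eq_of_coord_eq hs.1 hs'.1 (by rw [hs.2, hs'.2, h])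

end HasGerm

theorem IsGeodesicOn.mono (h : IsGeodesicOn γ I) (hJ : J ⊆ I) : IsGeodesicOn γ J := fun _ ht =>
  (h.exists_hasGerm (hJ ht)).imp fun _ hg => hg.mono hJ

theorem IsGeodesicOn.continuousOn (h : IsGeodesicOn γ I) : ContinuousOn γ I := fun _ ht =>
  let ⟨_, hg⟩ := h.exists_hasGerm ht
  hg.continuousWithinAt ht

theorem IsGeodesicOn.comp_add_mul {c ε : ℝ} (h : IsGeodesicOn γ I) (hε : |ε| = 1)
    (hJ : Set.MapsTo (fun s => c + ε * s) J I) : IsGeodesicOn (fun s => γ (c + ε * s)) J :=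
  fun _ ht =>
    let ⟨g, hg⟩ := h.exists_hasGerm (hJ ht)
    let ⟨k, hk⟩ := exists_smul_axis_eq_add_mul g c hε
    ⟨k, hg.comp_add_mul hJ hk⟩

theorem velocity_congr (h : Set.EqOn β γ I) (ht : t ∈ I) : velocity β I t = velocity γ I t := by
  have hd : derivWithin (fun s => (coord (β t) (β s) : ℂ)) I t =
      derivWithin (fun s => (coord (γ t) (γ s) : ℂ)) I t :=
    derivWithin_congr (fun s hs => by rw [h ht, h hs]) (by rw [h ht])
  rw [velocity, velocity, hd, h ht]

theorem IsGeodesicOn.velocity_mono (h : IsGeodesicOn γ I) (hJ : J ⊆ I) (ht : t ∈ J)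
    (hJu : UniqueDiffWithinAt ℝ J t) : velocity γ J t = velocity γ I t := by
  obtain ⟨g, hg⟩ := h.exists_hasGerm (hJ ht)
  rw [(hg.mono hJ).velocity_eq ht hJu, hg.velocity_eq (hJ ht) (hJu.mono hJ)]

end

theorem forall_mem_of_frequently {X : Type*} [TopologicalSpace X] {I : Set X}
    (hI : IsPreconnected I) {P : X → Prop} {t₀ : X} (ht₀ : t₀ ∈ I) (h₀ : ∀ᶠ s in 𝓝[I] t₀, P s)
    (step : ∀ t ∈ I, (∃ᶠ s in 𝓝[I] t, P s ∧ s ≠ t) → ∀ᶠ s in 𝓝[I] t, P s) :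
    ∀ t ∈ I, P t := by
  have := Subtype.preconnectedSpace hI
  set U : Set I := {t | ∀ᶠ s : I in 𝓝 t, P s}
  have hUP : ∀ t ∈ U, P t := fun t ht => Filter.Eventually.self_of_nhds (p := fun s : I => P s) ht
  have hopen : IsOpen U := isOpen_setOfPred_eventually_nhds
  have hclosed : IsClosed U := by
    refine isClosed_iff_frequently.2 fun t ht => ?_
    by_cases htU : t ∈ U
    · exact htU
    refine (eventually_nhds_subtype_iff I t P).2 (step t t.2 ?_)
    refine (frequently_nhds_subtype_iff I t fun s => P s ∧ s ≠ t).1 (ht.mono fun s hs => ?_)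
    exact ⟨hUP s hs, fun hst => htU (Subtype.ext hst ▸ hs)⟩
  have hU : U = Set.univ := IsClopen.eq_univ ⟨hclosed, hopen⟩
    ⟨⟨t₀, ht₀⟩, (eventually_nhds_subtype_iff I ⟨t₀, ht₀⟩ P).2 h₀⟩
  exact fun t ht => hUP ⟨t, ht⟩ (hU ▸ Set.mem_univ _)

section

variable {S : Type*} [TopologicalSpace S] [ChartedSpace HalfPlane S]
  {γ β : ℝ → S} {I J : Set ℝ} {a b c t : ℝ} {p : S} {g k : GL (Fin 2) ℝ}

theorem HasGerm.smul_axis_eq_of_velocity_eq (hγ : HasGerm γ I t (γ t) g)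
    (hβ : HasGerm β J t (β t) k) (htI : t ∈ I) (htJ : t ∈ J) (hI : UniqueDiffWithinAt ℝ I t)
    (hJ : UniqueDiffWithinAt ℝ J t) (hv : velocity γ I t = velocity β J t) (u : ℝ) :
    g • axis u = k • axis u := by
  rw [hγ.velocity_eq htI hI, hβ.velocity_eq htJ hJ, TangentVec.mk.injEq] at hv
  refine Hyp.smul_axis_eq_of_velocity_eq ?_ hv.2 u
  rw [← hγ.coord_eq htI, ← hβ.coord_eq htJ, hv.1]

theorem eqOn_of_velocity_eq [T2Space S] (hI : IsPreconnected I) (hγ : IsGeodesicOn γ I)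
    (hβ : IsGeodesicOn β I) (ht : t ∈ I) (hu : UniqueDiffWithinAt ℝ I t)
    (hv : velocity γ I t = velocity β I t) : Set.EqOn γ β I := by
  refine forall_mem_of_frequently hI ht ?_ fun s hs hf => ?_
  · obtain ⟨g, hg⟩ := hγ.exists_hasGerm ht
    obtain ⟨k, hk⟩ := hβ.exists_hasGerm ht
    have hp : γ t = β t := congrArg TangentVec.base hv
    exact hg.eventuallyEq (hp ▸ hk) (hg.smul_axis_eq_of_velocity_eq hk ht ht hu hu hv)
  · obtain ⟨g, hg⟩ := hγ.exists_hasGerm hs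
    obtain ⟨k, hk⟩ := hβ.exists_hasGerm hs
    have hp : γ s = β s := tendsto_nhds_unique_of_frequently_eq
      (hγ.continuousOn s hs) (hβ.continuousOn s hs) (hf.mono fun _ h => h.1)
    rw [← hp] at hk
    obtain ⟨r, ⟨hr, hne⟩, ⟨-, hgr⟩, ⟨-, hkr⟩⟩ :=
      (hf.and_eventually (Filter.Eventually.and hg hk)).exists
    exact hg.eventuallyEq hk (smul_axis_eq_of_eq_of_eq hne
      (by rw [← hgr, ← hkr, hr]) (by rw [← hg.coord_eq hs, ← hk.coord_eq hs, hp]))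

theorem HasGerm.re_eq_zero [HyperbolicSurface S] (h : HasGerm γ I t p g) (hI : I ∈ 𝓝 t)
    (ht : γ t ∈ bdry S) (u : ℝ) : (g • axis u).re = 0 :=
  re_smul_axis_eq_zero_of_eventually_nonneg
    ((h.mem_bdry_iff.self_of_nhdsWithin (mem_of_mem_nhds hI)).1 ht)
    ((nhdsWithin_eq_nhds.2 hI).ge h.re_nonneg) u

namespace IsGeodesicOn

theorem mem_bdry_of_eventually [HyperbolicSurface S] (hI : IsPreconnected I)
    (hγ : IsGeodesicOn γ I) (ht : t ∈ I) (h : ∀ᶠ s in 𝓝[I] t, γ s ∈ bdry S) :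
    ∀ s ∈ I, γ s ∈ bdry S := by
  refine forall_mem_of_frequently hI ht h fun s hs hf => ?_
  obtain ⟨g, hg⟩ := hγ.exists_hasGerm hs
  have hf' : ∃ᶠ r in 𝓝[I] s, (g • axis r).re = 0 ∧ r ≠ s :=
    (hf.and_eventually hg.mem_bdry_iff).mono fun r hr => ⟨hr.2.1 hr.1.1, hr.1.2⟩
  have hcont : Continuous fun r => (g • axis r).re :=
    UpperHalfPlane.continuous_re.comp (continuous_smul_axis g)
  have hs0 : (g • axis s).re = 0 := isClosed_singleton.mem_of_frequently_of_tendsto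
    (hf'.mono fun _ hr => hr.1) (hcont.tendsto s |>.mono_left nhdsWithin_le_nhds)
  obtain ⟨r, hr, hne⟩ := hf'.exists
  filter_upwards [hg.mem_bdry_iff] with u hu
  exact hu.2 (re_smul_axis_eq_zero_of_ne hne hr hs0 u)

theorem mem_bdry_of_mem_nhds [HyperbolicSurface S] (hI : IsPreconnected I)
    (hγ : IsGeodesicOn γ I) (htI : I ∈ 𝓝 t) (ht : γ t ∈ bdry S) : ∀ s ∈ I, γ s ∈ bdry S := by
  obtain ⟨g, hg⟩ := hγ.exists_hasGerm (mem_of_mem_nhds htI)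
  exact hγ.mem_bdry_of_eventually hI (mem_of_mem_nhds htI)
    (hg.mem_bdry_iff.mono fun s hs => hs.2 (hg.re_eq_zero htI ht s))

theorem congr (hγ : IsGeodesicOn γ I) (h : Set.EqOn β γ I) : IsGeodesicOn β I := fun t ht => by
  obtain ⟨g, hg⟩ := hγ.exists_hasGerm ht
  exact ⟨g, h ht ▸ hg.congr h⟩

theorem union_Icc (hab : a ≤ b) (hbc : b ≤ c) (h₁ : IsGeodesicOn γ (Set.Icc a b))
    (h₂ : IsGeodesicOn γ (Set.Icc b c)) (hg₁ : HasGerm γ (Set.Icc a b) b (γ b) g)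
    (hg₂ : HasGerm γ (Set.Icc b c) b (γ b) g) : IsGeodesicOn γ (Set.Icc a c) := by
  intro t ht
  change ∃ k, HasGerm γ (Set.Icc a c) t (γ t) k
  rcases lt_trichotomy t b with htb | rfl | htb
  · obtain ⟨k, hk⟩ := h₁.exists_hasGerm ⟨ht.1, htb.le⟩
    refine ⟨k, ?_⟩
    rw [HasGerm, ← nhdsWithin_inter_of_mem' (nhdsWithin_le_nhds (Iic_mem_nhds htb))]
    exact hk.mono fun s hs => ⟨hs.1.1, hs.2⟩
  · exact ⟨g, Set.Icc_union_Icc_eq_Icc hab hbc ▸ hg₁.union hg₂⟩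
  · obtain ⟨k, hk⟩ := h₂.exists_hasGerm ⟨htb.le, ht.2⟩
    refine ⟨k, ?_⟩
    rw [HasGerm, ← nhdsWithin_inter_of_mem' (nhdsWithin_le_nhds (Ici_mem_nhds htb))]
    exact hk.mono fun s hs => ⟨hs.2, hs.1.2⟩

end IsGeodesicOn

theorem exists_hasGerm_univ_of_notMem_bdry (hp : p ∉ bdry S)
    (h : coord p p = g • axis t) : ∃ β : ℝ → S, HasGerm β Set.univ t p g := by
  have hpos : 0 < (coord p p).re := lt_of_le_of_ne (coord_re_nonneg p p) (Ne.symm hp)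
  have hsurj : ∀ᶠ z in 𝓝 (coord p p), ∃ q ∈ (chartAt HalfPlane p).source, coord p q = z := by
    change _ ∈ 𝓝 ((chartAt HalfPlane p p : HalfPlane) : ℍ)
    rw [← map_coe_chart_nhds (mem_chart_source HalfPlane p) hpos]
    exact Filter.image_mem_map (chart_source_mem_nhds HalfPlane p)
  rw [h] at hsurj
  obtain ⟨β, hβ⟩ := (((continuous_smul_axis g).tendsto t).eventually hsurj).choice
  exact ⟨β, by rwa [HasGerm, nhdsWithin_univ]⟩

theorem isGeodesicOn_of_coord_eq [HyperbolicSurface S]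
    (h : ∀ s ∈ I, γ s ∈ (chartAt HalfPlane p).source ∧ coord p (γ s) = g • axis s) :
    IsGeodesicOn γ I := fun _ ht =>
  HasGerm.exists_hasGerm_self (p := p) (g := g) (Filter.mem_of_superset self_mem_nhdsWithin h) ht

theorem IsGeodesicOn.exists_extension [HyperbolicSurface S] (hab : a ≤ b)
    (hγ : IsGeodesicOn γ (Set.Icc a b)) (hb : γ b ∉ bdry S) :
    ∃ c > b, ∃ β : ℝ → S, Set.EqOn β γ (Set.Icc a b) ∧ IsGeodesicOn β (Set.Icc a c) := by
  have hbI : b ∈ Set.Icc a b := Set.right_mem_Icc.2 hab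
  obtain ⟨g, hg⟩ := hγ.exists_hasGerm hbI
  obtain ⟨δ, hδ⟩ := exists_hasGerm_univ_of_notMem_bdry hb (hg.coord_eq hbI)
  obtain ⟨c, hbc : b < c, hc⟩ := mem_nhdsGT_iff_exists_Ioc_subset.1
    (hδ.mono (Set.subset_univ (Set.Ioi b)))
  set β : ℝ → S := fun s => if s ≤ b then γ s else δ s
  have hβγ : Set.EqOn β γ (Set.Icc a b) := fun s hs => if_pos hs.2
  have hβ : ∀ s ∈ Set.Icc b c,
      β s ∈ (chartAt HalfPlane (γ b)).source ∧ coord (γ b) (β s) = g • axis s := by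
    intro s hs
    rcases hs.1.eq_or_lt with rfl | hbs
    · rw [hβγ hbI]
      exact ⟨mem_chart_source _ _, hg.coord_eq hbI⟩
    · rw [show β s = δ s from if_neg hbs.not_ge]
      exact hc ⟨hbs, hs.2⟩
  have hβb : β b = γ b := hβγ hbI
  exact ⟨c, hbc, β, hβγ, union_Icc hab hbc.le (hγ.congr hβγ) (isGeodesicOn_of_coord_eq hβ)
    (hβb ▸ hg.congr hβγ) (hβb ▸ Filter.mem_of_superset self_mem_nhdsWithin hβ)⟩

end

/-! ### Geodesic rays -/

section

variable {S : Type*} [TopologicalSpace S] [ChartedSpace HalfPlane S]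
  {γ β : ℝ → S} {I J : Set ℝ} {a b s t T T' : ℝ} {v : TangentVec S}

namespace IsRay

theorem mono (h : IsRay v γ T) (hT : T' ≤ T) : IsRay v γ T' := by
  have hsub : Set.Icc 0 T' ⊆ Set.Icc 0 T := Set.Icc_subset_Icc_right hT
  refine ⟨h.1, h.2.1.mono hsub, fun hT' => ?_⟩
  have h0 : (0 : ℝ) ∈ Set.Icc 0 T' := Set.left_mem_Icc.2 hT'.le
  rw [h.2.1.velocity_mono hsub h0 (uniqueDiffOn_Icc hT' 0 h0), h.2.2 (hT'.trans_le hT)]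

theorem eq [T2Space S] (h : IsRay v γ T) (h' : IsRay v β T) (hT : 0 ≤ T) : γ T = β T := by
  rcases hT.eq_or_lt with rfl | hpos
  · rw [h.1, h'.1]
  · have h0 : (0 : ℝ) ∈ Set.Icc 0 T := Set.left_mem_Icc.2 hT
    exact eqOn_of_velocity_eq isPreconnected_Icc h.2.1 h'.2.1 h0 (uniqueDiffOn_Icc hpos 0 h0)
      ((h.2.2 hpos).trans (h'.2.2 hpos).symm) (Set.right_mem_Icc.2 hT)

theorem ray_eq [T2Space S] (h : IsRay v γ T) (hT : 0 ≤ T) : ray v T = γ T := by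
  have hex : ∃ γ : ℝ → S, IsRay v γ T := ⟨γ, h⟩
  rw [ray, dif_pos hex]
  exact hex.choose_spec.eq h hT

end IsRay

namespace IsGeodesicOn

theorem velocity_comp_add_mul {c ε : ℝ} (hγ : IsGeodesicOn γ I) (hε : |ε| = 1)
    (hJ : Set.MapsTo (fun s => c + ε * s) J I) (ht : t ∈ J) (hJu : UniqueDiffWithinAt ℝ J t)
    (hIu : UniqueDiffWithinAt ℝ I (c + ε * t)) :
    velocity (fun s => γ (c + ε * s)) J t =
      ⟨γ (c + ε * t), ε * (velocity γ I (c + ε * t)).vec⟩ := by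
  obtain ⟨g, hg⟩ := hγ.exists_hasGerm (hJ ht)
  obtain ⟨k, hk⟩ := exists_smul_axis_eq_add_mul g c hε
  rw [(hg.comp_add_mul hJ hk).velocity_eq ht hJu, hg.velocity_eq (hJ ht) hIu,
    axisVelocity_eq_mul hk]

theorem isRay_comp_add_mul {ε : ℝ} (hγ : IsGeodesicOn γ I) (hε : |ε| = 1)
    (hI : UniqueDiffWithinAt ℝ I t) (hs : Set.MapsTo (fun r => t + ε * r) (Set.Icc 0 s) I) :
    IsRay ⟨γ t, ε * (velocity γ I t).vec⟩ (fun r => γ (t + ε * r)) s := by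
  have ht0 : t + ε * 0 = t := by ring
  refine ⟨congrArg γ ht0, hγ.comp_add_mul hε hs, fun hs0 => ?_⟩
  have h0 : (0 : ℝ) ∈ Set.Icc 0 s := Set.left_mem_Icc.2 hs0.le
  rw [hγ.velocity_comp_add_mul hε hs h0 (uniqueDiffOn_Icc hs0 0 h0) (by rwa [ht0]), ht0]

theorem isRay_velocity (hγ : IsGeodesicOn γ (Set.Icc a b)) (hab : a < b) (ht : t ∈ Set.Icc a b)
    (hs : s ≤ b - t) : IsRay (velocity γ (Set.Icc a b) t) (fun r => γ (t + r)) s := by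
  have hm : Set.MapsTo (fun r => t + 1 * r) (Set.Icc 0 s) (Set.Icc a b) := fun r hr => by
    constructor <;> linarith [ht.1, hr.1, hr.2]
  have h := hγ.isRay_comp_add_mul abs_one (uniqueDiffOn_Icc hab t ht) hm
  simp only [Complex.ofReal_one, one_mul] at h
  exact h

theorem isRay_neg_velocity (hγ : IsGeodesicOn γ (Set.Icc a b)) (hab : a < b)
    (ht : t ∈ Set.Icc a b) (hs : s ≤ t - a) :
    IsRay (-velocity γ (Set.Icc a b) t) (fun r => γ (t - r)) s := by
  have hm : Set.MapsTo (fun r => t + -1 * r) (Set.Icc 0 s) (Set.Icc a b) := fun r hr => by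
    constructor <;> linarith [ht.2, hr.1, hr.2]
  have h := hγ.isRay_comp_add_mul (by rw [abs_neg, abs_one]) (uniqueDiffOn_Icc hab t ht) hm
  simp only [Complex.ofReal_neg, Complex.ofReal_one, neg_one_mul, ← sub_eq_add_neg] at h
  exact h

end IsGeodesicOn

theorem IsRay.reverse (hβ : IsRay (-v) β s) (hs : 0 < s) (t : ℝ) :
    IsGeodesicOn (fun u => β (t - u)) (Set.Icc (t - s) t) ∧
      velocity (fun u => β (t - u)) (Set.Icc (t - s) t) t = v := by
  have hm : Set.MapsTo (fun u => t + -1 * u) (Set.Icc (t - s) t) (Set.Icc 0 s) := fun u hu => by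
    constructor <;> linarith [hu.1, hu.2]
  have htI : t ∈ Set.Icc (t - s) t := Set.right_mem_Icc.2 (by linarith)
  have hε : |(-1 : ℝ)| = 1 := by rw [abs_neg, abs_one]
  have hρ := hβ.2.1.comp_add_mul hε hm
  have hv := hβ.2.1.velocity_comp_add_mul hε hm htI (uniqueDiffOn_Icc (by linarith) t htI)
    (uniqueDiffOn_Icc hs _ (hm htI))
  simp only [neg_one_mul, ← sub_eq_add_neg, Complex.ofReal_neg, Complex.ofReal_one, sub_self,
    hβ.2.2 hs] at hρ hv
  exact ⟨hρ, hv.trans (TangentVec.ext hβ.1 (neg_neg _))⟩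

namespace IsGeodesicOn

theorem exists_prepend (hγ : IsGeodesicOn γ (Set.Icc a b)) (hab : a < b) (ht : t ∈ Set.Icc a b)
    (hβ : IsRay (-velocity γ (Set.Icc a b) t) β s) (hs : 0 < s) :
    ∃ δ : ℝ → S, Set.EqOn δ (fun u => β (t - u)) (Set.Icc (t - s) t) ∧
      Set.EqOn δ γ (Set.Icc t b) ∧ IsGeodesicOn δ (Set.Icc (t - s) b) := by
  have hβt : β (t - t) = γ t := by rw [sub_self, hβ.1]; rfl
  set δ : ℝ → S := fun u => if u ≤ t then β (t - u) else γ u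
  have hδβ : Set.EqOn δ (fun u => β (t - u)) (Set.Icc (t - s) t) := fun u hu => if_pos hu.2
  have hδγ : Set.EqOn δ γ (Set.Icc t b) := fun u hu => by
    rcases hu.1.eq_or_lt with rfl | htu
    · exact (if_pos le_rfl).trans hβt
    · exact if_neg htu.not_ge
  have htI : t ∈ Set.Icc (t - s) t := Set.right_mem_Icc.2 (by linarith)
  obtain ⟨hρ, hv⟩ := hβ.reverse hs t
  obtain ⟨k, hk⟩ := hρ.exists_hasGerm htI
  obtain ⟨g, hg⟩ := hγ.exists_hasGerm ht
  have hkg := hk.smul_axis_eq_of_velocity_eq hg htI ht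
    (uniqueDiffOn_Icc (by linarith) t htI) (uniqueDiffOn_Icc hab t ht) hv
  have hsub : Set.Icc t b ⊆ Set.Icc a b := Set.Icc_subset_Icc_left ht.1
  have hgδ : HasGerm δ (Set.Icc t b) t (δ t) g := by
    rw [hδγ (Set.left_mem_Icc.2 ht.2)]
    exact (hg.mono hsub).congr hδγ
  have hkδ : HasGerm δ (Set.Icc (t - s) t) t (δ t) k := hδβ htI ▸ hk.congr hδβ
  refine ⟨δ, hδβ, hδγ, union_Icc htI.1 ht.2 (hρ.congr hδβ) ((hγ.mono hsub).congr hδγ) ?_ hgδ⟩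
  simpa only [HasGerm, hkg] using hkδ

theorem rayDomain_neg_velocity [T2Space S] [HyperbolicSurface S]
    (hγ : IsGeodesicOn γ (Set.Icc a b)) (hab : a < b) (ht : t ∈ Set.Icc a b)
    (ha : γ a ∈ bdry S) (hb : γ b ∉ bdry S) :
    rayDomain (-velocity γ (Set.Icc a b) t) = Set.Icc 0 (t - a) := by
  refine Set.Subset.antisymm ?_ fun s hs => ⟨hs.1, _, hγ.isRay_neg_velocity hab ht hs.2⟩
  rintro s ⟨hs0, β, hβ⟩
  refine ⟨hs0, not_lt.1 fun hlt => hb ?_⟩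
  have hat : 0 ≤ t - a := sub_nonneg.2 ht.1
  obtain ⟨δ, hδβ, hδγ, hδ⟩ := hγ.exists_prepend hab ht hβ (hat.trans_lt hlt)
  have hδa : δ a = γ a := by
    rw [hδβ ⟨by linarith, ht.1⟩]
    exact ((hβ.mono hlt.le).eq (hγ.isRay_neg_velocity hab ht le_rfl) hat).trans (by simp)
  rw [← hδγ (Set.right_mem_Icc.2 ht.2)]
  exact hδ.mem_bdry_of_mem_nhds isPreconnected_Icc (Icc_mem_nhds (by linarith) hab)
    (hδa ▸ ha) b (Set.right_mem_Icc.2 (by linarith [ht.2]))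

end IsGeodesicOn

end

/-! ### Prolonging a lasso -/

theorem exists_smul_axis_eq_of_re_eq_zero {g : GL (Fin 2) ℝ} (hg : ∀ u, (g • axis u).re = 0)
    {z : ℍ} (hz : z.re = 0) : ∃ u, g • axis u = z := by
  have hg' : ∀ u, g • axis u = (1 : GL (Fin 2) ℝ) • axis (Real.log (g • axis u).im) := fun u => by
    rw [one_smul, ← eq_axis_of_re_eq_zero (hg u)]
  obtain ⟨ε, hε, h⟩ := exists_smul_axis_eq_add_mul_sub zero_ne_one (hg' 0) (hg' 1)
  refine ⟨ε * (Real.log z.im - Real.log (g • axis 0).im), ?_⟩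
  have hε' : ε * ε = 1 := by rw [← abs_mul_abs_self, hε, one_mul]
  rw [h, one_smul, sub_zero, ← mul_assoc, hε', one_mul, add_sub_cancel,
    ← eq_axis_of_re_eq_zero hz]

section

variable {S : Type*} [TopologicalSpace S] [ChartedSpace HalfPlane S]
  {α β : ℝ → S} {T₁ T₂ T₃ c : ℝ} {p : S} {g h : GL (Fin 2) ℝ}

theorem HasGerm.Iio {γ : ℝ → S} {a b : ℝ} (h : HasGerm γ (Set.Icc a b) b p g) (hab : a < b) :
    HasGerm γ (Set.Iio b) b p g := by
  rw [HasGerm, ← nhdsWithin_Ioo_eq_nhdsLT hab]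
  exact h.mono Set.Ioo_subset_Icc_self

theorem HasGerm.exists_injOn {γ : ℝ → S} {I : Set ℝ} {t : ℝ} (h : HasGerm γ I t p g) :
    ∃ U ∈ 𝓝[I] t, Set.InjOn γ U :=
  ⟨_, h, fun _ hx _ hy hxy =>
    smul_axis_injective g (hx.2.symm.trans ((congrArg (coord p) hxy).trans hy.2))⟩

namespace IsPositiveLasso

theorem congr (hα : IsPositiveLasso α T₁ T₂ T₃) (h : Set.EqOn β α (Set.Icc T₁ T₂)) :
    IsPositiveLasso β T₁ T₂ T₃ where
  geodesic := hα.geodesic.congr h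
  base_mem := h (Set.left_mem_Icc.2 (hα.le.trans hα.lt.le)) ▸ hα.base_mem
  injOn := hα.injOn.congr (h.symm.mono Set.Ioo_subset_Icc_self)
  le := hα.le
  lt := hα.lt
  knot := by
    rw [h ⟨hα.le, hα.lt.le⟩, h (Set.right_mem_Icc.2 (hα.le.trans hα.lt.le)), hα.knot]

theorem not_forall_smul_axis_eq (hα : IsPositiveLasso α T₁ T₂ T₃) (hT : T₁ < T₃)
    (hg : HasGerm α (Set.Icc T₁ T₂) T₃ p g) (hh : HasGerm α (Set.Icc T₁ T₂) T₂ p h) (ε : ℝ) :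
    ¬ ∀ u, h • axis u = g • axis (T₃ + ε * (u - T₂)) := by
  intro H
  have hT₂ : T₁ < T₂ := hT.trans hα.lt
  have hcont : Continuous fun u => T₃ + ε * (u - T₂) := by fun_prop
  have hφ : Filter.Tendsto (fun u => T₃ + ε * (u - T₂)) (𝓝[<] T₂) (𝓝 T₃) := by
    simpa only [sub_self, mul_zero, add_zero] using
      (hcont.tendsto T₂).mono_left nhdsWithin_le_nhds
  have hid : Filter.Tendsto (fun u => u) (𝓝[<] T₂) (𝓝 T₂) := nhdsWithin_le_nhds
  have hev : ∀ᶠ _ in 𝓝[<] T₂, False := by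
    filter_upwards [hφ.eventually (hg.eventually_nhds (Icc_mem_nhds hT hα.lt)), hh.Iio hT₂,
      hφ.eventually (Ioo_mem_nhds hT hα.lt), Ioo_mem_nhdsLT hT₂, hφ.eventually_lt hid hα.lt]
      with u hgu hhu hφu hu hlt
    exact hlt.ne (hα.injOn hφu hu (eq_of_coord_eq hgu.1 hhu.1 (by rw [hgu.2, hhu.2, H])))
  exact hev.exists.elim fun _ h => h

theorem smul_axis_ne (hα : IsPositiveLasso α T₁ T₂ T₃) (hT : T₁ < T₃)
    (hg : HasGerm α (Set.Icc T₁ T₂) T₃ p g) (hh : HasGerm α (Set.Icc T₁ T₂) T₂ p h) {s : ℝ}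
    (hs : s ≠ T₂) (t : ℝ) : h • axis s ≠ g • axis t := by
  intro hst
  have hknot : h • axis T₂ = g • axis T₃ := by
    rw [← hh.coord_eq (Set.right_mem_Icc.2 (hT.trans hα.lt).le), ← hg.coord_eq ⟨hT.le, hα.lt.le⟩,
      hα.knot]
  obtain ⟨ε, -, hε⟩ := exists_smul_axis_eq_add_mul_sub hs.symm hknot hst
  exact hα.not_forall_smul_axis_eq hT hg hh ε hε

theorem exists_hasGerm_knot (hα : IsPositiveLasso α T₁ T₂ T₃) : ∃ g h,
    HasGerm α (Set.Icc T₁ T₂) T₃ (α T₂) g ∧ HasGerm α (Set.Icc T₁ T₂) T₂ (α T₂) h := by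
  obtain ⟨g, hg⟩ := hα.geodesic.exists_hasGerm ⟨hα.le, hα.lt.le⟩
  obtain ⟨h, hh⟩ := hα.geodesic.exists_hasGerm (Set.right_mem_Icc.2 (hα.le.trans hα.lt.le))
  exact ⟨g, h, hα.knot ▸ hg, hh⟩

variable [HyperbolicSurface S]

theorem knot_notMem_bdry (hα : IsPositiveLasso α T₁ T₂ T₃) (hT : T₁ < T₃) : α T₃ ∉ bdry S := by
  intro hb
  have hT₂ : T₁ < T₂ := hT.trans hα.lt
  obtain ⟨g, h, hg, hh⟩ := hα.exists_hasGerm_knot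
  have hall := hα.geodesic.mem_bdry_of_mem_nhds isPreconnected_Icc (Icc_mem_nhds hT hα.lt) hb
  have hg0 := hg.re_eq_zero (Icc_mem_nhds hT hα.lt) hb
  have hev : ∀ᶠ s in 𝓝[<] T₂, (h • axis s).re = 0 := by
    filter_upwards [(hh.Iio hT₂).mem_bdry_iff, Ioo_mem_nhdsLT hT₂] with s hs hsI
    exact hs.1 (hall s (Set.Ioo_subset_Icc_self hsI))
  obtain ⟨s, hs0, hs⟩ := (hev.and self_mem_nhdsWithin).exists
  obtain ⟨u, hu⟩ := exists_smul_axis_eq_of_re_eq_zero hg0 hs0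
  exact hα.smul_axis_ne hT hg hh (ne_of_lt hs) u hu.symm

theorem notMem_bdry (hα : IsPositiveLasso α T₁ T₂ T₃) (hT : T₁ < T₃) {s : ℝ}
    (hs : s ∈ Set.Ioc T₁ T₂) : α s ∉ bdry S := by
  intro hb
  have hk := hα.knot_notMem_bdry hT
  rcases hs.2.eq_or_lt with rfl | hlt
  · exact hk (hα.knot ▸ hb)
  · exact hk (hα.geodesic.mem_bdry_of_mem_nhds isPreconnected_Icc (Icc_mem_nhds hs.1 hlt) hb T₃
      ⟨hα.le, hα.lt.le⟩)

theorem eq_knot (hα : IsPositiveLasso α T₁ T₂ T₃) (hT : T₁ < T₃) {x y : ℝ} (hx : T₁ ≤ x)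
    (hxy : x < y) (hy : y ≤ T₂) (h : α x = α y) : x = T₃ ∧ y = T₂ := by
  have hx₁ : T₁ < x := by
    refine lt_of_le_of_ne hx ?_
    rintro rfl
    exact hα.notMem_bdry hT ⟨hxy, hy⟩ (h ▸ hα.base_mem)
  rcases hy.eq_or_lt with rfl | hlt
  · exact ⟨hα.injOn ⟨hx₁, hxy⟩ ⟨hT, hα.lt⟩ (h.trans hα.knot.symm), rfl⟩
  · exact absurd (hα.injOn ⟨hx₁, hxy.trans hlt⟩ ⟨hx₁.trans hxy, hlt⟩ h) hxy.ne

theorem eventually_notMem_image [T2Space S] (hα : IsPositiveLasso α T₁ T₂ T₃) (hT : T₁ < T₃)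
    (hc : T₂ < c) (hαc : IsGeodesicOn α (Set.Icc T₁ c)) :
    ∀ᶠ y in 𝓝[>] T₂, α y ∉ α '' Set.Icc T₁ T₂ := by
  have hI₂ : Set.Icc T₁ c ∈ 𝓝 T₂ := Icc_mem_nhds (hT.trans hα.lt) hc
  have hI₃ : Set.Icc T₁ c ∈ 𝓝 T₃ := Icc_mem_nhds hT (hα.lt.trans hc)
  have hsub : Set.Icc T₁ T₂ ⊆ Set.Icc T₁ c := Set.Icc_subset_Icc_right hc.le
  obtain ⟨h, hh⟩ := hαc.exists_hasGerm (mem_of_mem_nhds hI₂)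
  obtain ⟨g, hg⟩ := hαc.exists_hasGerm (mem_of_mem_nhds hI₃)
  rw [hα.knot] at hg
  obtain ⟨U, hU, hinj⟩ := hh.exists_injOn
  rw [nhdsWithin_eq_nhds.2 hI₂] at hU
  obtain ⟨V, hV, hgV⟩ := Filter.eventually_iff_exists_mem.1 (hg.eventually_nhds hI₃)
  -- Away from `T₂` and `T₃`, the compact rest of the lasso misses a neighbourhood of the knot.
  set K := Set.Icc T₁ T₂ \ (interior U ∪ interior V)
  have hK : IsCompact (α '' K) :=
    (isCompact_Icc.diff (isOpen_interior.union isOpen_interior)).image_of_continuousOn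
      (hαc.continuousOn.mono (Set.sdiff_subset.trans hsub))
  have hT₂K : α T₂ ∉ α '' K := by
    rintro ⟨x, ⟨hxI, hxUV⟩, hx⟩
    rcases hxI.2.eq_or_lt with rfl | hlt
    · exact hxUV (Or.inl (mem_interior_iff_mem_nhds.2 hU))
    · obtain ⟨rfl, -⟩ := hα.eq_knot hT hxI.1 hlt le_rfl hx
      exact hxUV (Or.inr (mem_interior_iff_mem_nhds.2 hV))
  have hcont : ContinuousAt α T₂ := hαc.continuousOn.continuousAt hI₂
  filter_upwards [nhdsWithin_le_nhds hU, nhdsWithin_le_nhds (hh.eventually_nhds hI₂),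
    nhdsWithin_le_nhds (hcont.eventually (hK.isClosed.isOpen_compl.mem_nhds hT₂K)),
    self_mem_nhdsWithin] with y hyU hyh hyK hy
  rintro ⟨x, hxI, hxy⟩
  by_cases hxU : x ∈ U
  · exact absurd (hinj hxU hyU hxy) (hxI.2.trans_lt hy).ne
  · by_cases hxV : x ∈ V
    · refine hα.smul_axis_ne hT (hg.mono hsub) (hh.mono hsub) (ne_of_gt hy) x ?_
      rw [← hyh.2, ← (hgV x hxV).2, hxy]
    · exact hyK ⟨x, ⟨hxI, fun hx => hx.elim (fun h => hxU (interior_subset h))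
        fun h => hxV (interior_subset h)⟩, hxy⟩

end IsPositiveLasso

/-- A geodesic path `β : [T₁, T] → S` which extends a lasso on `[T₁, T₂]`, and whose only double
point is the knot `β T₃ = β T₂`. -/
structure IsProlongedLasso (β : ℝ → S) (T₁ T₂ T₃ T : ℝ) : Prop where
  geodesic : IsGeodesicOn β (Set.Icc T₁ T)
  base_mem : β T₁ ∈ bdry S
  notMem_bdry : ∀ s ∈ Set.Ioc T₁ T, β s ∉ bdry S
  base_lt : T₁ < T₃
  lt : T₃ < T₂
  lt_end : T₂ < T
  knot : β T₃ = β T₂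
  eq_knot : ∀ x y, T₁ ≤ x → x < y → y ≤ T → β x = β y → x = T₃ ∧ y = T₂

theorem IsPositiveLasso.exists_isProlongedLasso [T2Space S] [HyperbolicSurface S]
    (hα : IsPositiveLasso α T₁ T₂ T₃) (hT : T₁ < T₃) :
    ∃ T β, Set.EqOn β α (Set.Icc T₁ T₂) ∧ IsProlongedLasso β T₁ T₂ T₃ T := by
  have hT₂ : T₁ < T₂ := hT.trans hα.lt
  obtain ⟨c, hc, β, hβα, hβ⟩ := hα.geodesic.exists_extension hT₂.le
    (hα.notMem_bdry hT (Set.right_mem_Ioc.2 hT₂))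
  replace hα := hα.congr hβα
  have hI₂ : Set.Icc T₁ c ∈ 𝓝 T₂ := Icc_mem_nhds hT₂ hc
  obtain ⟨h, hh⟩ := hβ.exists_hasGerm (mem_of_mem_nhds hI₂)
  obtain ⟨U, hU, hinj⟩ := hh.exists_injOn
  rw [nhdsWithin_eq_nhds.2 hI₂] at hU
  obtain ⟨T, hT₂T : T₂ < T, hsub⟩ := mem_nhdsGT_iff_exists_Ioc_subset.1
    (((hα.eventually_notMem_image hT hc hβ).and (nhdsWithin_le_nhds hU)).and
      (Ioo_mem_nhdsGT hc))
  have hTc : T < c := (hsub (Set.right_mem_Ioc.2 hT₂T)).2.2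
  refine ⟨T, β, hβα, hβ.mono (Set.Icc_subset_Icc_right hTc.le), hα.base_mem, fun s hs hsb => ?_,
    hT, hα.lt, hT₂T, hα.knot, fun x y hx hxy hy heq => ?_⟩
  · exact hα.knot_notMem_bdry hT (hβ.mem_bdry_of_mem_nhds isPreconnected_Icc
      (Icc_mem_nhds hs.1 (hs.2.trans_lt hTc)) hsb T₃ ⟨hT.le, (hα.lt.trans hc).le⟩)
  · rcases le_or_gt y T₂ with hyT₂ | hyT₂
    · exact hα.eq_knot hT hx hxy hyT₂ heq
    · obtain ⟨⟨hyI, hyU⟩, -⟩ := hsub ⟨hyT₂, hy⟩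
      rcases le_or_gt x T₂ with hxT₂ | hxT₂
      · exact absurd ⟨x, ⟨hx, hxT₂⟩, heq⟩ hyI
      · exact absurd (hinj (hsub ⟨hxT₂, hxy.le.trans hy⟩).1.2 hyU heq) hxy.ne

end

/-! ### Stopping times and graphs -/

section

variable {S : Type*} [TopologicalSpace S] [ChartedSpace HalfPlane S]

theorem endComponent_subset_bdry (v : TangentVec S) (τ : EReal) : endComponent v τ ⊆ bdry S := by
  rintro q ⟨s, -, -, hq⟩
  exact connectedComponentIn_subset _ _ hq

theorem graph_diff_bdry (v : TangentVec S) :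
    graph v \ bdry S = (arc v (stopTimes v).1 ∪ arc (-v) (stopTimes v).2) \ bdry S := by
  rw [graph, Set.union_sdiff_distrib, Set.union_eq_left, Set.sdiff_eq_empty.2]
  · exact Set.empty_subset _
  · exact Set.union_subset (endComponent_subset_bdry _ _) (endComponent_subset_bdry _ _)

namespace IsProlongedLasso

variable {β : ℝ → S} {T₁ T₂ T₃ T t s : ℝ} {τ : EReal}

theorem image_Icc_diff_bdry (H : IsProlongedLasso β T₁ T₂ T₃ T) :
    β '' Set.Icc T₁ T₂ \ bdry S = β '' Set.Ioc T₁ T₂ := by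
  rw [← Set.Ioc_insert_left (H.base_lt.trans H.lt).le, Set.image_insert_eq,
    Set.insert_sdiff_of_mem _ H.base_mem, sdiff_eq_left, Set.disjoint_left]
  rintro _ ⟨s, hs, rfl⟩
  exact H.notMem_bdry s ⟨hs.1, hs.2.trans H.lt_end.le⟩

theorem base_lt_end (H : IsProlongedLasso β T₁ T₂ T₃ T) : T₁ < T :=
  (H.base_lt.trans H.lt).trans H.lt_end

theorem mem_rayDomain (H : IsProlongedLasso β T₁ T₂ T₃ T) (ht : t ∈ Set.Icc T₁ T)
    (hs₀ : 0 ≤ s) (hs : s ≤ T - t) : s ∈ rayDomain (velocity β (Set.Icc T₁ T) t) :=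
  ⟨hs₀, _, H.geodesic.isRay_velocity H.base_lt_end ht hs⟩

section

variable [T2Space S]

theorem ray_velocity (H : IsProlongedLasso β T₁ T₂ T₃ T) (ht : t ∈ Set.Icc T₁ T)
    (hs₀ : 0 ≤ s) (hs : s ≤ T - t) : ray (velocity β (Set.Icc T₁ T) t) s = β (t + s) :=
  (H.geodesic.isRay_velocity H.base_lt_end ht hs).ray_eq hs₀

theorem arc_velocity (H : IsProlongedLasso β T₁ T₂ T₃ T) (ht : t ∈ Set.Icc T₁ T) {c : ℝ}
    (hc : c ≤ T) : arc (velocity β (Set.Icc T₁ T) t) ((c - t : ℝ) : EReal) = β '' Set.Icc t c := by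
  refine Set.Subset.antisymm ?_ ?_
  · rintro _ ⟨s, ⟨hs, hsc⟩, rfl⟩
    have hs₀ : 0 ≤ s := hs.1
    have hsc : s ≤ c - t := EReal.coe_le_coe_iff.1 hsc
    exact ⟨t + s, ⟨by linarith, by linarith⟩, (H.ray_velocity ht hs₀ (by linarith)).symm⟩
  · rintro _ ⟨x, hx, rfl⟩
    have hx₀ : 0 ≤ x - t := sub_nonneg.2 hx.1
    have hxT : x - t ≤ T - t := by linarith [hx.2]
    refine ⟨x - t, ⟨H.mem_rayDomain ht hx₀ hxT, EReal.coe_le_coe_iff.2 (by linarith [hx.2])⟩, ?_⟩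
    rw [H.ray_velocity ht hx₀ hxT, add_sub_cancel]

theorem ray_neg_velocity (H : IsProlongedLasso β T₁ T₂ T₃ T) (ht : t ∈ Set.Icc T₁ T)
    (hs₀ : 0 ≤ s) (hs : s ≤ t - T₁) : ray (-velocity β (Set.Icc T₁ T) t) s = β (t - s) :=
  (H.geodesic.isRay_neg_velocity H.base_lt_end ht hs).ray_eq hs₀

variable [HyperbolicSurface S]

theorem rayDomain_neg_velocity (H : IsProlongedLasso β T₁ T₂ T₃ T) (ht : t ∈ Set.Icc T₁ T) :
    rayDomain (-velocity β (Set.Icc T₁ T) t) = Set.Icc 0 (t - T₁) :=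
  H.geodesic.rayDomain_neg_velocity H.base_lt_end ht H.base_mem
    (H.notMem_bdry T (Set.right_mem_Ioc.2 H.base_lt_end))

theorem arc_neg_velocity (H : IsProlongedLasso β T₁ T₂ T₃ T) (ht : t ∈ Set.Icc T₁ T) :
    arc (-velocity β (Set.Icc T₁ T) t) ((t - T₁ : ℝ) : EReal) = β '' Set.Icc T₁ t := by
  have hdom := H.rayDomain_neg_velocity ht
  refine Set.Subset.antisymm ?_ ?_
  · rintro _ ⟨s, ⟨hs, -⟩, rfl⟩
    obtain ⟨hs₀, hs₁⟩ := hdom.subset hs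
    exact ⟨t - s, ⟨by linarith, by linarith⟩, (H.ray_neg_velocity ht hs₀ hs₁).symm⟩
  · rintro _ ⟨x, hx, rfl⟩
    have hx₀ : 0 ≤ t - x := sub_nonneg.2 hx.2
    have hx₁ : t - x ≤ t - T₁ := by linarith [hx.1]
    refine ⟨t - x, ⟨hdom ▸ ⟨hx₀, hx₁⟩, EReal.coe_le_coe_iff.2 hx₁⟩, ?_⟩
    rw [H.ray_neg_velocity ht hx₀ hx₁, sub_sub_cancel]

theorem eq_and_le_of_forward_hit (H : IsProlongedLasso β T₁ T₂ T₃ T) (ht : t ∈ Set.Icc T₁ T)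
    (hs : s ∈ rayDomain (velocity β (Set.Icc T₁ T) t)) (hsT : s < T - t)
    (hit : HitsBdry (velocity β (Set.Icc T₁ T) t) s ∨ HitsSelf (velocity β (Set.Icc T₁ T) t) s ∨
      (0 < s ∧ ∃ r ∈ Set.Icc 0 s ∩ rayDomain (-velocity β (Set.Icc T₁ T) t), (r : EReal) ≤ τ ∧
        ray (-velocity β (Set.Icc T₁ T) t) r = ray (velocity β (Set.Icc T₁ T) t) s)) :
    s = T₂ - t ∧ t ≤ (T₂ + T₃) / 2 := by
  have ⟨ht₁, ht₂⟩ := ht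
  have hray := H.ray_velocity ht hs.1 hsT.le
  rcases hit with (⟨hpos, hb⟩ | hmax) | ⟨r, hr, hmeet⟩ | ⟨hpos, r, ⟨hr, hrd⟩, -, hmeet⟩
  · exact absurd (hray ▸ hb) (H.notMem_bdry _ ⟨by linarith, by linarith⟩)
  · exact absurd (hmax _ (H.mem_rayDomain ht (sub_nonneg.2 ht₂) le_rfl)) hsT.not_ge
  · rw [hray, H.ray_velocity ht hr.1 (hr.2.trans hsT).le] at hmeet
    obtain ⟨hr₃, hs₂⟩ := H.eq_knot (t + r) (t + s) (by linarith [hr.1]) (by linarith [hr.2])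
      (by linarith) hmeet
    constructor <;> linarith [hr.1, H.lt]
  · rw [H.rayDomain_neg_velocity ht] at hrd
    rw [hray, H.ray_neg_velocity ht hr.1 hrd.2] at hmeet
    obtain ⟨hr₃, hs₂⟩ := H.eq_knot (t - r) (t + s) (by linarith [hrd.2]) (by linarith [hr.1])
      (by linarith) hmeet
    constructor <;> linarith [hr.2]

theorem stopForward_eq (H : IsProlongedLasso β T₁ T₂ T₃ T) (ht₁ : T₁ ≤ t)
    (ht : t ≤ (T₂ + T₃) / 2) (hτ : ((t - T₁ : ℝ) : EReal) ≤ τ) :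
    stopForward (velocity β (Set.Icc T₁ T) t) τ = ((T₂ - t : ℝ) : EReal) := by
  have hlt := H.lt
  have hend := H.lt_end
  have hbase := H.base_lt
  have htT : t ∈ Set.Icc T₁ T := ⟨ht₁, by linarith⟩
  have hs₀ : 0 ≤ T₂ - t := by linarith
  have hsT : T₂ - t ≤ T - t := by linarith
  have hray := H.ray_velocity htT hs₀ hsT
  rw [add_sub_cancel] at hray
  refine le_antisymm (sInf_le ⟨T₂ - t, ⟨H.mem_rayDomain htT hs₀ hsT, Or.inr ?_⟩, rfl⟩)
    (le_sInf ?_)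
  · rcases le_or_gt t T₃ with ht₃ | ht₃
    · refine Or.inl ⟨T₃ - t, ⟨sub_nonneg.2 ht₃, by linarith⟩, ?_⟩
      rw [hray, H.ray_velocity htT (sub_nonneg.2 ht₃) (by linarith), add_sub_cancel, H.knot]
    · have hr : t - T₃ ≤ t - T₁ := by linarith
      refine Or.inr ⟨by linarith, t - T₃, ⟨⟨by linarith, by linarith⟩, ?_⟩, ?_, ?_⟩
      · exact H.rayDomain_neg_velocity htT ▸ ⟨by linarith, hr⟩
      · exact (EReal.coe_le_coe_iff.2 hr).trans hτ
      · rw [hray, H.ray_neg_velocity htT (by linarith) hr, sub_sub_cancel, H.knot]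
  · rintro _ ⟨s, ⟨hs, hit⟩, rfl⟩
    refine EReal.coe_le_coe_iff.2 (le_of_not_gt fun hs₂ => ?_)
    exact hs₂.ne (H.eq_and_le_of_forward_hit htT hs (hs₂.trans_le hsT) hit).1

theorem le_stopForward (H : IsProlongedLasso β T₁ T₂ T₃ T) (htT : t ∈ Set.Icc T₁ T)
    (ht : (T₂ + T₃) / 2 < t) (τ : EReal) :
    ((T - t : ℝ) : EReal) ≤ stopForward (velocity β (Set.Icc T₁ T) t) τ := by
  refine le_sInf ?_
  rintro _ ⟨s, ⟨hs, hit⟩, rfl⟩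
  refine EReal.coe_le_coe_iff.2 (le_of_not_gt fun hsT => ?_)
  exact ht.not_ge (H.eq_and_le_of_forward_hit htT hs hsT hit).2

theorem eq_of_backward_hit (H : IsProlongedLasso β T₁ T₂ T₃ T) (ht₁ : T₁ ≤ t)
    (ht : t ≤ (T₂ + T₃) / 2) (hs : s ∈ rayDomain (-velocity β (Set.Icc T₁ T) t))
    (hsτ : τ ≤ ((T₂ - t : ℝ) : EReal) ∨ s ≤ T₂ - t)
    (hit : HitsBdry (-velocity β (Set.Icc T₁ T) t) s ∨
      HitsSelf (-velocity β (Set.Icc T₁ T) t) s ∨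
      ∃ r ∈ Set.Ico 0 s ∩ rayDomain (velocity β (Set.Icc T₁ T) t), (r : EReal) ≤ τ ∧
        ray (velocity β (Set.Icc T₁ T) t) r = ray (-velocity β (Set.Icc T₁ T) t) s) :
    s = t - T₁ := by
  have hlt := H.lt
  have hend := H.lt_end
  have htT : t ∈ Set.Icc T₁ T := ⟨ht₁, by linarith⟩
  have hdom := H.rayDomain_neg_velocity htT
  obtain ⟨hs₀, hs₁⟩ := hdom.subset hs
  have hray := H.ray_neg_velocity htT hs₀ hs₁
  rcases hit with (⟨-, hb⟩ | hmax) | ⟨r, hr, hmeet⟩ | ⟨r, ⟨hr, -⟩, hrτ, hmeet⟩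
  · by_contra hne
    have := lt_of_le_of_ne hs₁ hne
    exact H.notMem_bdry _ ⟨by linarith, by linarith⟩ (hray ▸ hb)
  · exact le_antisymm hs₁ (hmax _ (hdom ▸ Set.right_mem_Icc.2 (sub_nonneg.2 ht₁)))
  · rw [hray, H.ray_neg_velocity htT hr.1 (hr.2.le.trans hs₁)] at hmeet
    obtain ⟨-, hr₂⟩ := H.eq_knot (t - s) (t - r) (by linarith) (by linarith [hr.2])
      (by linarith [hr.1]) hmeet.symm
    linarith [hr.1]
  · have hr₂ : r ≤ T₂ - t := hsτ.elim (fun h => EReal.coe_le_coe_iff.1 (hrτ.trans h))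
      (hr.2.le.trans ·)
    rw [hray, H.ray_velocity htT hr.1 (by linarith)] at hmeet
    obtain ⟨hs₃, hr₃⟩ := H.eq_knot (t - s) (t + r) (by linarith) (by linarith [hr.1, hr.2])
      (by linarith) hmeet.symm
    linarith [hr.2]

theorem stopBackward_eq (H : IsProlongedLasso β T₁ T₂ T₃ T) (ht₁ : T₁ ≤ t)
    (ht : t ≤ (T₂ + T₃) / 2) (hτ : τ ≤ ((T₂ - t : ℝ) : EReal) ∨
      stopBackward (velocity β (Set.Icc T₁ T) t) τ < ((T₂ - t : ℝ) : EReal)) :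
    stopBackward (velocity β (Set.Icc T₁ T) t) τ = ((t - T₁ : ℝ) : EReal) := by
  have hdom := H.rayDomain_neg_velocity ⟨ht₁, by linarith [H.lt, H.lt_end]⟩
  have hmem : t - T₁ ∈ rayDomain (-velocity β (Set.Icc T₁ T) t) :=
    hdom ▸ Set.right_mem_Icc.2 (sub_nonneg.2 ht₁)
  refine eq_of_le_of_not_lt
    (sInf_le ⟨t - T₁, ⟨hmem, Or.inl (Or.inr fun s hs => (hdom.subset hs).2)⟩, rfl⟩) fun hlt => ?_
  rcases hτ with hτ | hlt₂
  · obtain ⟨_, ⟨s, ⟨hs, hit⟩, rfl⟩, hst⟩ := sInf_lt_iff.1 hlt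
    exact (EReal.coe_lt_coe_iff.1 hst).ne (H.eq_of_backward_hit ht₁ ht hs (Or.inl hτ) hit)
  · obtain ⟨_, ⟨s, ⟨hs, hit⟩, rfl⟩, hst⟩ := sInf_lt_iff.1 (lt_min hlt hlt₂)
    obtain ⟨hst, hst₂⟩ := lt_min_iff.1 hst
    exact (EReal.coe_lt_coe_iff.1 hst).ne
      (H.eq_of_backward_hit ht₁ ht hs (Or.inr (EReal.coe_lt_coe_iff.1 hst₂).le) hit)

theorem stopTimes_eq (H : IsProlongedLasso β T₁ T₂ T₃ T) (ht₁ : T₁ ≤ t)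
    (ht : t ≤ (T₂ + T₃) / 2) : stopTimes (velocity β (Set.Icc T₁ T) t) =
      (((T₂ - t : ℝ) : EReal), ((t - T₁ : ℝ) : EReal)) := by
  have hforward := H.stopForward_eq ht₁ ht le_top
  rw [stopTimes, hforward]
  split_ifs with hle
  · rw [H.stopBackward_eq ht₁ ht (Or.inl le_rfl)]
  · rw [H.stopBackward_eq ht₁ ht (Or.inr (not_le.1 hle)), H.stopForward_eq ht₁ ht le_rfl]

theorem le_stopTimes_fst (H : IsProlongedLasso β T₁ T₂ T₃ T) (htT : t ∈ Set.Icc T₁ T)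
    (ht : (T₂ + T₃) / 2 < t) :
    ((T - t : ℝ) : EReal) ≤ (stopTimes (velocity β (Set.Icc T₁ T) t)).1 := by
  rw [stopTimes]
  split_ifs <;> exact H.le_stopForward htT ht _

theorem graph_diff_bdry_eq (H : IsProlongedLasso β T₁ T₂ T₃ T) (ht₁ : T₁ ≤ t)
    (ht : t ≤ (T₂ + T₃) / 2) :
    graph (velocity β (Set.Icc T₁ T) t) \ bdry S = β '' Set.Ioc T₁ T₂ := by
  have ht₂ : t ≤ T₂ := by linarith [H.lt]
  have htT : t ∈ Set.Icc T₁ T := ⟨ht₁, ht₂.trans H.lt_end.le⟩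
  rw [graph_diff_bdry, H.stopTimes_eq ht₁ ht, H.arc_velocity htT H.lt_end.le,
    H.arc_neg_velocity htT, Set.union_comm, ← Set.image_union, Set.Icc_union_Icc_eq_Icc ht₁ ht₂,
    H.image_Icc_diff_bdry]

theorem graph_diff_bdry_ne (H : IsProlongedLasso β T₁ T₂ T₃ T) (htT : t ∈ Set.Icc T₁ T)
    (ht : (T₂ + T₃) / 2 < t) :
    graph (velocity β (Set.Icc T₁ T) t) \ bdry S ≠ β '' Set.Ioc T₁ T₂ := by
  intro heq
  have hT₀ : 0 ≤ T - t := sub_nonneg.2 htT.2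
  have hT : β T ∈ graph (velocity β (Set.Icc T₁ T) t) \ bdry S := by
    rw [graph_diff_bdry]
    refine ⟨Or.inl ⟨T - t, ⟨H.mem_rayDomain htT hT₀ le_rfl, H.le_stopTimes_fst htT ht⟩, ?_⟩,
      H.notMem_bdry T (Set.right_mem_Ioc.2 H.base_lt_end)⟩
    rw [H.ray_velocity htT hT₀ le_rfl, add_sub_cancel]
  obtain ⟨x, hx, hxT⟩ := heq.subset hT
  exact H.lt_end.ne' (H.eq_knot x T hx.1.le (hx.2.trans_lt H.lt_end) le_rfl hxT).2

end

end IsProlongedLasso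

end

end Hyp

theorem proposition4p6_general {S : Type*} [TopologicalSpace S] [T2Space S]
    [ChartedSpace Hyp.HalfPlane S] [Hyp.HyperbolicSurface S]
    (α : ℝ → S) (T₁ T₂ T₃ : ℝ) (hα : Hyp.IsPositiveLasso α T₁ T₂ T₃) (hT : T₁ < T₃)
    (t : ℝ) (ht : t ∈ Set.Icc T₁ T₂) :
    Hyp.graph (Hyp.velocity α (Set.Icc T₁ T₂) t) \ Hyp.bdry S = α '' Set.Ioc T₁ T₂ ↔
      T₁ ≤ t ∧ t ≤ (T₂ + T₃) / 2 := by
  obtain ⟨T, β, hβα, H⟩ := hα.exists_isProlongedLasso hT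
  have hT₂ : T₁ < T₂ := hT.trans hα.lt
  have hv : Hyp.velocity α (Set.Icc T₁ T₂) t = Hyp.velocity β (Set.Icc T₁ T) t :=
    (Hyp.velocity_congr hβα ht).symm.trans (H.geodesic.velocity_mono
      (Set.Icc_subset_Icc_right H.lt_end.le) ht (uniqueDiffOn_Icc hT₂ t ht))
  rw [hv, ← (hβα.mono Set.Ioc_subset_Icc_self).image_eq]
  refine ⟨fun h => ⟨ht.1, le_of_not_gt fun hmid => ?_⟩, fun h => H.graph_diff_bdry_eq h.1 h.2⟩
  exact H.graph_diff_bdry_ne ⟨ht.1, ht.2.trans H.lt_end.le⟩ hmid h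

theorem proposition4p6 {S : Type*} [TopologicalSpace S] [T2Space S] [CompactSpace S]
    [ChartedSpace Hyp.HalfPlane S] [Hyp.HyperbolicSurface S]
    (α : ℝ → S) (T₁ T₂ T₃ : ℝ) (hα : Hyp.IsPositiveLasso α T₁ T₂ T₃) (hT : T₁ < T₃)
    (t : ℝ) (ht : t ∈ Set.Icc T₁ T₂) :
    Hyp.graph (Hyp.velocity α (Set.Icc T₁ T₂) t) \ Hyp.bdry S = α '' Set.Ioc T₁ T₂ ↔
      T₁ ≤ t ∧ t ≤ (T₂ + T₃) / 2 :=
  proposition4p6_general α T₁ T₂ T₃ hα hT t ht
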